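/- Let $K=\mathbb R$ or $\mathbb C$. Let $k,k',d'\ge 0$ and $$H=\mathbb Z_{2n_1}\times\dots\times\mathbb Z_{2n_k}\times\mathbb Z_{2n'_1}\times\dots\times\mathbb Z_{2n'_{k'}}\times\mathbb Z_{m'_1}\times\dots\times\mathbb Z_{m'_{d'}},$$ where the $n_i$ are positive even integers and the $n'_i$ and $m'_i$ are positive odd integers, and assume that $H$ is not isomorphic to $\mathbb Z_2^{a}\times\mathbb Z_4^{b}$ for any $a,b\ge 0$. (The group $H$ has even order exactly when $k+k'\ge 1$; the case $k+k'=0$ is allowed.) Let $T$ be the Takasaki quandle of $H$, that is, the set $H$ with $a\triangleright b=2b-a$, and write $R_b(a)=a\triangleright b$. Let $\mathrm{Inn}(T)$ be the group of permutations of $T$ generated by all $R_b$. Let $K[T]$ be the quandle ring: the $K$-vector space with basis $T$ and the bilinear product extending $\triangleright$. For an orbit $X$ of $\mathrm{Inn}(T)$ on $T$, let $K[X]\subseteq K[T]$ be the span of $X$ and let $\mathrm{Inn}(X)$ be the group generated by the restrictions $R_b|_X$, $b\in T$; it acts linearly on $K[X]$ by permuting the basis $X$. For an abelian group $A$, let $\mathrm{Dih}(A)=\langle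 A,s\mid s^2=1,\ shs^{-1}=h^{-1}\ (h\in A)\rangle= A\rtimes\mathbb Z_2$. Put $\tilde H=2H=\{h+h : h\in H\}$ and $N=(|\tilde H|-2^k)/2$. A right ideal is called simple if it is nonzero and contains no right ideal other than $0$ and itself. Then: 1. $\mathrm{Inn}(T)$ has exactly $2^{k+k'}$ orbits $X_i$ on $T$, each $K[X_i]$ is a right ideal of $K[T]$, and $K[T]=\bigoplus_i K[X_i]$. 2. There are exactly $2^k$ characters $\phi_1,\dots,\phi_{2^k}:\mathrm{Dih}(\tilde H)\to K^\times$ with $\phi_j(s)=1$, and, up to equivalence, exactly $N$ irreducible representations $\psi_1,\dots,\psi_N$ of $\mathrm{Dih}(\tilde H)$ over $K$ of degree two. 3. For every choice of base points $a_i\in X_i$ there are isomorphisms $e_i:\mathrm{Inn}(X_i)\to\mathrm{Dih}(\tilde H)$ with $e_i(R_b|_{X_i})=2(b-a_i)\cdot s$ for all $b\in H$ (in particular $e_i(R_{a_i}|_{X_i})=s$). 4. With these identifications, each $K[X_i]$ has $\mathrm{Inn}(X_i)$-stable subspaces $U_{i,j}$ ($1\le j\le 2^k$) of dimension one, on which $\mathrm{Inn}(X_i)$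 acts through $\phi_j\circ e_i$, and $V_{i,j}$ ($1\le j\le N$) of dimension two, affording a representation equivalent to $\psi_j\circ e_i$, such that every $U_{i,j}$ and every $V_{i,j}$ is a simple right ideal of $K[T]$ and $$K[X_i]=\bigoplus_{j=1}^{2^k}U_{i,j}\oplus\bigoplus_{j=1}^{N}V_{i,j},\qquad K[T]=\bigoplus_{i=1}^{2^{k+k'}}\Bigl(\bigoplus_{j=1}^{2^k}U_{i,j}\oplus\bigoplus_{j=1}^{N}V_{i,j}\Bigr).$$ -/

import Mathlib

open scoped Quandles

noncomputable section

/-! ### Quandles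

Mathlib writes the quandle operation as a left action; the operation `x ▷ y` of a right quandle is
`y ◃ x`, and the right multiplication `R_y : x ↦ x ▷ y` is `Rack.act' y`. -/

/-- The underlying set of the Takasaki quandle of an additive abelian group `H`. -/
def Takasaki (H : Type*) : Type _ := H

/-- The operation `a ▷ b = 2 b - a` of an abelian group, with its right argument first. -/
def Takasaki.op {H : Type*} [AddCommGroup H] (b a : H) : H := 2 • b - a

/-- The Takasaki quandle of `H`: `a ▷ b = b ◃ a = 2 b - a`. -/
instance Takasaki.instQuandle (H : Type*) [AddCommGroup H] : Quandle (Takasaki H) where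
  act := Takasaki.op (H := H)
  self_distrib {x y z} := by
    have h : ∀ x y z : H, op x (op y z) = op (op x y) (op x z) := fun x y z => by
      unfold op; module
    exact h x y z
  invAct := Takasaki.op (H := H)
  left_inv x y := by
    have h : ∀ x y : H, op x (op x y) = y := fun x y => by unfold op; module
    exact h x y
  right_inv x y := by
    have h : ∀ x y : H, op x (op x y) = y := fun x y => by unfold op; module
    exact h x y
  fix {x} := by
    have h : ∀ x : H, op x x = x := fun x => by unfold op; module
    exact h x

section Quandle

variable {X : Type*} [Quandle X]

variable (X) in
/-- The inner automorphism group `Inn(X)`, generated by all right multiplications `R_x`. -/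
def Inn : Subgroup (Equiv.Perm X) :=
  Subgroup.closure (Set.range (Rack.act' : X → Equiv.Perm X))

variable (X) in
/-- The set of orbits of `Inn(X)` on `X`; the subset of `X` given by `ω : InnOrbit X` is
`ω.orbit`. -/
abbrev InnOrbit : Type _ := MulAction.orbitRel.Quotient (Inn X) X

/-- The right multiplication `R_x` as an element of `Inn(X)`. -/
def Inn.rightMul (x : X) : Inn X :=
  ⟨Rack.act' x, Subgroup.subset_closure (Set.mem_range_self x)⟩

/-- The restriction of `R_x` to the orbit `ω`; here `x` is any element of `X`. -/
def orbitRightMul (ω : InnOrbit X) (x : X) : Equiv.Perm ω.orbit :=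
  MulAction.toPerm (Inn.rightMul x)

/-- The group `Inn(X_ω)`, generated by the restrictions to the orbit `ω` of the right
multiplications by all elements of `X`. -/
def InnOn (ω : InnOrbit X) : Subgroup (Equiv.Perm ω.orbit) :=
  Subgroup.closure (Set.range (orbitRightMul ω))

/-- The restriction of `R_x` to the orbit `ω` as an element of `Inn(X_ω)`. -/
def InnOn.rightMul (ω : InnOrbit X) (x : X) : InnOn ω :=
  ⟨orbitRightMul ω x, Subgroup.subset_closure (Set.mem_range_self x)⟩

end Quandle

/-! ### Quandle rings -/

/-- The quandle ring `K[X]`: finite linear combinations of elements of `X`. -/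
def QuandleRing (K X : Type*) [Ring K] : Type _ := X →₀ K

namespace QuandleRing

variable {K X : Type*}

instance [Ring K] : AddCommGroup (QuandleRing K X) := inferInstanceAs (AddCommGroup (X →₀ K))

instance [Ring K] : Module K (QuandleRing K X) := inferInstanceAs (Module K (X →₀ K))

/-- The product `(∑ α_x x) (∑ β_y y) = ∑ α_x β_y (x ▷ y)`. -/
def mul [Ring K] [Quandle X] (u v : X →₀ K) : X →₀ K :=
  u.sum fun x α => v.sum fun y β => Finsupp.single (y ◃ x) (α * β)

instance [Ring K] [Quandle X] : NonUnitalNonAssocRing (QuandleRing K X) where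
  mul := mul
  left_distrib u v w := by
    have h : ∀ u v w : X →₀ K, mul u (v + w) = mul u v + mul u w := fun u v w => by
      classical
      unfold mul
      rw [← Finsupp.sum_add]
      refine Finsupp.sum_congr fun x _ => Finsupp.sum_add_index' ?_ ?_
      · simp
      · intro y b c
        rw [mul_add, Finsupp.single_add]
    exact h u v w
  right_distrib u v w := by
    have h : ∀ u v w : X →₀ K, mul (u + v) w = mul u w + mul v w := fun u v w => by
      classical
      unfold mul
      refine Finsupp.sum_add_index' ?_ ?_
      · simp [Finsupp.sum]
      · intro x b c
        rw [← Finsupp.sum_add]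
        refine Finsupp.sum_congr fun y _ => ?_
        rw [add_mul, Finsupp.single_add]
    exact h u v w
  zero_mul u := by
    have h : ∀ u : X →₀ K, mul 0 u = 0 := fun u => Finsupp.sum_zero_index
    exact h u
  mul_zero u := by
    have h : ∀ u : X →₀ K, mul u 0 = 0 := fun u => by simp [mul, Finsupp.sum]
    exact h u

variable [Field K] [Quandle X]

/-- A right ideal of `K[X]`. -/
def IsRightIdeal (I : Submodule K (QuandleRing K X)) : Prop :=
  ∀ u ∈ I, ∀ v : QuandleRing K X, u * v ∈ I

/-- A simple right ideal of `K[X]`: a nonzero right ideal that contains no right ideal other than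
`0` and itself. -/
def IsSimpleRightIdeal (I : Submodule K (QuandleRing K X)) : Prop :=
  IsRightIdeal I ∧ I ≠ ⊥ ∧ ∀ J : Submodule K (QuandleRing K X), IsRightIdeal J → J ≤ I →
    J = ⊥ ∨ J = I

variable (K)

/-- The inclusion of `K[X_ω]`, the space with basis the orbit `X_ω`, into `K[X]`. -/
def orbitIncl (ω : InnOrbit X) : (ω.orbit →₀ K) →ₗ[K] QuandleRing K X :=
  (Finsupp.lmapDomain K K (Subtype.val : ω.orbit → X) : (ω.orbit →₀ K) →ₗ[K] (X →₀ K))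

/-- The representation of `Inn(X_ω)` on `K[X_ω]` permuting the basis `X_ω`, that is
`ρ(R_x) y = y ▷ x`. -/
def orbitRep (ω : InnOrbit X) : Representation K (InnOn ω) (ω.orbit →₀ K) where
  toFun g := Finsupp.lmapDomain K K (g : Equiv.Perm ω.orbit)
  map_one' := Finsupp.lmapDomain_id K K
  map_mul' g h := Finsupp.lmapDomain_comp K K (h : Equiv.Perm ω.orbit) (g : Equiv.Perm ω.orbit)

end QuandleRing

/-- `M` is the internal direct sum of the family of submodules `W`. -/
def IsDirectSumOf {ι K M : Type*} [Field K] [AddCommGroup M] [Module K M]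
    (W : ι → Submodule K M) : Prop :=
  letI := Classical.decEq ι
  DirectSum.IsInternal W

/-! ### Generalised dihedral groups -/

/-- The action of `ℤ/2` on an abelian group (written multiplicatively) by inversion. -/
def inversionAction (A : Type*) [AddCommGroup A] :
    Multiplicative (ZMod 2) →* MulAut (Multiplicative A) where
  toFun t := if t = 1 then 1 else MulEquiv.inv (Multiplicative A)
  map_one' := if_pos rfl
  map_mul' t u := by
    have h : ∀ t : Multiplicative (ZMod 2), t = 1 ∨ t = Multiplicative.ofAdd 1 := by decide
    have h1 : (Multiplicative.ofAdd (1 : ZMod 2)) ≠ 1 := by decide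
    have h2 : (Multiplicative.ofAdd (1 : ZMod 2)) * Multiplicative.ofAdd 1 = 1 := by decide
    rcases h t with rfl | rfl <;> rcases h u with rfl | rfl <;> simp only [one_mul, mul_one, if_true,
      if_neg h1, h2]
    ext x
    simp

/-- The generalised dihedral group `Dih(A) = A ⋊ ℤ/2`. -/
abbrev Dih (A : Type*) [AddCommGroup A] : Type _ :=
  Multiplicative A ⋊[inversionAction A] Multiplicative (ZMod 2)

/-- The element of `Dih(A)` given by `a ∈ A`. -/
def Dih.r {A : Type*} [AddCommGroup A] (a : A) : Dih A :=
  SemidirectProduct.inl (Multiplicative.ofAdd a)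

/-- The involution `s` of `Dih(A)`, with `s a s⁻¹ = a⁻¹` for `a ∈ A`. -/
def Dih.s {A : Type*} [AddCommGroup A] : Dih A :=
  SemidirectProduct.inr (Multiplicative.ofAdd 1)

/-! ### The groups in question -/

/-- `∏ ℤ/(2 n_i) × ∏ ℤ/(2 n'_i) × ∏ ℤ/(m'_i)`. -/
abbrev CyclicProduct {k k' d' : ℕ} (n : Fin k → ℕ) (n' : Fin k' → ℕ) (m' : Fin d' → ℕ) : Type :=
  (∀ i, ZMod (2 * n i)) × (∀ i, ZMod (2 * n' i)) × (∀ i, ZMod (m' i))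

/-- The subgroup `2H = {h + h | h ∈ H}`. -/
def twice (H : Type*) [AddCommGroup H] : AddSubgroup H := (nsmulAddMonoidHom 2).range

/-- The element `2 h` of `2H`. -/
def twice.mk {H : Type*} [AddCommGroup H] (h : H) : twice H :=
  ⟨2 • h, h, rfl⟩

end

/-!
Write `A = 2H`, let `χ` run through the complex characters of `A`, and regard `Re χ` and `Im χ` as
functions `A → K`, which makes sense over `ℝ` and `ℂ` alike.

The orbits of the Takasaki quandle are the cosets of `A` in `H`. A base point `a` identifies an
orbit with `A` through `x ↦ x - a`, and then `R_b` becomes `y ↦ 2 (b - a) - y`. So the group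
generated by the `R_b` acts as the group `Dih(A)` of all maps `y ↦ c ± y`; the action of `Dih(A)`
on `A` is faithful because `H` is not a product of copies of `ℤ/2` and `ℤ/4`, that is, because `A`
has an element `x` with `2x ≠ 0` (`Dih.perm_injective`, `CyclicProduct.exists_two_nsmul_ne_zero`,
`Takasaki.innOnEquiv`). Right multiplication by a basis element of `K[T]` is the action of `R_b`,
whence right ideals inside `K[X_ω]` are the same as invariant subspaces
(`QuandleRing.isSimpleRightIdeal_map_orbitIncl`).

It remains to decompose the functions on `A` under `Dih(A)`. By the addition formulas the span of
`Re χ` and `Im χ` is invariant: `A` acts by rotations through the angle of `χ`, and `s` by a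
reflection (`Dih.rotRep`, `Dih.charMap_intertwines`). If `χ ≠ χ⁻¹`, some rotation is not `± 1`,
and the span is irreducible of dimension two; if `χ = χ⁻¹`, then `Im χ = 0`, and the span is a
line on which `s` is trivial. The characters `χ` and `χ⁻¹` have the same span. By orthogonality of
characters these spans generate all functions (`Dih.iSup_range_charMap`), so taking one character
out of each pair `{χ, χ⁻¹}` gives a family of subspaces which generates and whose dimensions add
up to `|A|`; the sum is therefore direct (`isDirectSumOf_of_iSup_eq_top`).

An irreducible representation of degree two has an eigenvector of `s`, hence receives a nonzero
map that commutes with `A` from the functions on `A`, and Schur's lemma applied to the span of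
some `Re χ` and `Im χ` identifies it (`Dih.exists_rotRep_equiv`). Traces show that only `χ` and
`χ⁻¹` give the same representation (`Dih.eq_or_eq_neg_of_rotRep_equiv`).

The numbers follow from counting elements killed by `2`: `|H/2H| = |H[2]|` orbits and
`|A/2A| = |A[2]|` real characters of `A`.
-/

/-! ### The generalised dihedral group and its two basic representations -/

namespace Dih

variable {A : Type*} [AddCommGroup A]

theorem r_zero : Dih.r (0 : A) = 1 := rfl

theorem r_add (a b : A) : Dih.r (a + b) = Dih.r a * Dih.r b :=
  map_mul SemidirectProduct.inl (Multiplicative.ofAdd a) (Multiplicative.ofAdd b)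

theorem s_mul_s : (Dih.s : Dih A) * Dih.s = 1 := by
  rw [Dih.s, ← map_mul]
  exact map_one _

theorem s_inv : (Dih.s : Dih A)⁻¹ = Dih.s := inv_eq_of_mul_eq_one_left s_mul_s

theorem r_inv (a : A) : (Dih.r a)⁻¹ = Dih.r (-a) := by
  rw [inv_eq_iff_mul_eq_one, ← r_add, add_neg_cancel, r_zero]

theorem s_mul_r (a : A) : Dih.s * Dih.r a = Dih.r (-a) * Dih.s := by
  have h1 : (Multiplicative.ofAdd (1 : ZMod 2)) ≠ 1 := by decide
  ext
  · change 1 * inversionAction A (Multiplicative.ofAdd 1) (Multiplicative.ofAdd a) =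
      Multiplicative.ofAdd (-a) * inversionAction A 1 1
    simp [inversionAction, h1]
  · simp [Dih.s, Dih.r]

theorem eq_r_or_eq_r_mul_s (d : Dih A) : (∃ a, d = Dih.r a) ∨ ∃ a, d = Dih.r a * Dih.s := by
  have h2 : ∀ t : Multiplicative (ZMod 2), t = 1 ∨ t = Multiplicative.ofAdd 1 := by decide
  rw [← SemidirectProduct.inl_left_mul_inr_right d]
  rcases h2 d.right with h | h <;> rw [h]
  · exact Or.inl ⟨d.left.toAdd, by rw [map_one, mul_one]; rfl⟩
  · exact Or.inr ⟨d.left.toAdd, rfl⟩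

/-- A property that holds for all `r a` and for `s`, and passes to products, holds on `Dih(A)`. -/
theorem induction {p : Dih A → Prop} (hr : ∀ a, p (Dih.r a)) (hs : p Dih.s)
    (hmul : ∀ x y, p x → p y → p (x * y)) (d : Dih A) : p d := by
  rcases eq_r_or_eq_r_mul_s d with ⟨a, rfl⟩ | ⟨a, rfl⟩
  exacts [hr a, hmul _ _ (hr a) hs]

theorem hom_ext {M : Type*} [Monoid M] {f g : Dih A →* M} (hr : ∀ a, f (Dih.r a) = g (Dih.r a))
    (hs : f Dih.s = g Dih.s) : f = g :=
  MonoidHom.ext (induction hr hs fun x y hx hy => by rw [map_mul, map_mul, hx, hy])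

/-- The homomorphism from `Dih(A)` to a monoid (the target need not be a group) given by the images
`f a` of `r a` and `t` of `s`. -/
def lift {M : Type*} [Monoid M] (f : A → M) (t : M) (f0 : f 0 = 1)
    (hf : ∀ a b, f (a + b) = f a * f b) (ht : t * t = 1) (htf : ∀ a, t * f a = f (-a) * t) :
    Dih A →* M where
  toFun d := f d.left.toAdd * if d.right = 1 then 1 else t
  map_one' := by simp [f0]
  map_mul' x y := by
    have h2 : ∀ u : Multiplicative (ZMod 2), u = 1 ∨ u = Multiplicative.ofAdd 1 := by decide
    have h1 : (Multiplicative.ofAdd (1 : ZMod 2)) ≠ 1 := by decide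
    have h3 : (Multiplicative.ofAdd (1 : ZMod 2)) * Multiplicative.ofAdd 1 = 1 := by decide
    have hm : ∀ a b c d, f a * t * (f b * (c * d)) = f (a + -b) * (t * c) * d := by
      intro a b c d
      rw [hf]
      simp only [mul_assoc]
      rw [← mul_assoc t (f b), htf]
      simp only [mul_assoc]
    rcases h2 x.right with hx | hx <;> rcases h2 y.right with hy | hy
    · simp [hx, hy, hf]
    · simp [hx, hy, hf, mul_assoc]
    · have := hm x.left.toAdd y.left.toAdd 1 1
      simp only [mul_one] at this
      simp [hx, hy, inversionAction, h1, this]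
    · have := hm x.left.toAdd y.left.toAdd t 1
      simp only [mul_one, ht] at this
      simp [hx, hy, inversionAction, h1, h3, this]

section lift

variable {M : Type*} [Monoid M] (f : A → M) (t : M) (f0 : f 0 = 1)
  (hf : ∀ a b, f (a + b) = f a * f b) (ht : t * t = 1) (htf : ∀ a, t * f a = f (-a) * t)

@[simp]
theorem lift_r (a : A) : lift f t f0 hf ht htf (Dih.r a) = f a := by
  simp [lift, Dih.r]

@[simp]
theorem lift_s : lift f t f0 hf ht htf Dih.s = t := by
  have h1 : (Multiplicative.ofAdd (1 : ZMod 2)) ≠ 1 := by decide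
  simp [lift, Dih.s, h1, f0]

end lift

variable (A) in
/-- The action of `Dih(A)` on the set `A`, with `r c` the translation by `c` and `s` the
negation. -/
def perm : Dih A →* Equiv.Perm A :=
  lift Equiv.addLeft (Equiv.neg A) (by ext; simp) (fun a b => by ext; simp)
    (by ext; simp) (fun a => by ext; simp [add_comm])

@[simp]
theorem perm_r_apply (a x : A) : perm A (Dih.r a) x = a + x := by simp [perm]

@[simp]
theorem perm_s_apply (x : A) : perm A Dih.s x = -x := by simp [perm]

/-- The action of `Dih(A)` on `A` is faithful as soon as negation is not the identity of `A`. -/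
theorem perm_injective (hA : ∃ x : A, 2 • x ≠ 0) : Function.Injective (perm A) := by
  rw [injective_iff_map_eq_one]
  intro d hd
  have h0 := Equiv.congr_fun hd 0
  rcases eq_r_or_eq_r_mul_s d with ⟨a, rfl⟩ | ⟨a, rfl⟩
  · simp only [perm_r_apply, add_zero, Equiv.Perm.one_apply] at h0
    rw [h0, r_zero]
  · obtain ⟨x, hx⟩ := hA
    simp only [map_mul, Equiv.Perm.mul_apply, perm_r_apply, perm_s_apply, neg_zero, add_zero,
      Equiv.Perm.one_apply] at h0
    have h1 := Equiv.congr_fun hd x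
    simp only [map_mul, Equiv.Perm.mul_apply, perm_r_apply, perm_s_apply, h0, zero_add,
      Equiv.Perm.one_apply] at h1
    exact absurd (by rw [two_nsmul]; nth_rewrite 1 [← h1]; simp) hx

variable (K : Type*) [Field K]

variable (A) in
/-- The representation of `Dih(A)` on the functions `A → K` by permutation of the arguments. -/
def funRep : Representation K (Dih A) (A → K) where
  toFun d := LinearMap.funLeft K K (perm A d⁻¹)
  map_one' := by ext; simp
  map_mul' x y := by
    refine LinearMap.ext fun f => funext fun z => ?_
    simp [LinearMap.funLeft_apply]

theorem funRep_apply (d : Dih A) (f : A → K) (x : A) :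
    funRep A K d f x = f ((perm A d)⁻¹ x) := by
  rw [← map_inv]; rfl

@[simp]
theorem funRep_r_apply (a : A) (f : A → K) (x : A) :
    funRep A K (Dih.r a) f x = f (x - a) := by
  rw [funRep_apply, ← map_inv, r_inv, perm_r_apply, neg_add_eq_sub]

@[simp]
theorem funRep_s_apply (f : A → K) (x : A) : funRep A K Dih.s f x = f (-x) := by
  rw [funRep_apply, ← map_inv, s_inv, perm_s_apply]

end Dih

/-! ### Real and imaginary parts of characters -/

namespace Dih

variable {A : Type*} [AddCommGroup A] (K : Type*) [RCLike K]

/-- The real part of a complex character of `A`, as a function with values in `K`. -/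
noncomputable def reFun (χ : AddChar A ℂ) (x : A) : K := ((χ x).re : K)

/-- The imaginary part of a complex character of `A`, as a function with values in `K`. -/
noncomputable def imFun (χ : AddChar A ℂ) (x : A) : K := ((χ x).im : K)

section parts

variable (χ : AddChar A ℂ)

theorem reFun_zero : reFun K χ 0 = 1 := by simp [reFun]

theorem reFun_ne_zero (χ : AddChar A ℂ) : reFun K χ ≠ 0 := fun h =>
  one_ne_zero ((reFun_zero K χ).symm.trans (congrFun h 0))

theorem imFun_zero : imFun K χ 0 = 0 := by simp [imFun]

theorem reFun_add (x y : A) :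
    reFun K χ (x + y) = reFun K χ x * reFun K χ y - imFun K χ x * imFun K χ y := by
  simp [reFun, imFun, AddChar.map_add_eq_mul]

theorem imFun_add (x y : A) :
    imFun K χ (x + y) = reFun K χ x * imFun K χ y + imFun K χ x * reFun K χ y := by
  simp [reFun, imFun, AddChar.map_add_eq_mul]

variable [Finite A]

theorem reFun_neg (x : A) : reFun K χ (-x) = reFun K χ x := by
  simp [reFun, AddChar.map_neg_eq_conj]

theorem imFun_neg (x : A) : imFun K χ (-x) = -imFun K χ x := by
  simp [imFun, AddChar.map_neg_eq_conj]

theorem reFun_char_neg : reFun K (-χ) = reFun K χ :=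
  funext fun x => reFun_neg K χ x

theorem imFun_char_neg : imFun K (-χ) = -imFun K χ :=
  funext fun x => imFun_neg K χ x

theorem reFun_sub (x y : A) :
    reFun K χ (x - y) = reFun K χ x * reFun K χ y + imFun K χ x * imFun K χ y := by
  rw [sub_eq_add_neg, reFun_add, reFun_neg, imFun_neg]; ring

theorem imFun_sub (x y : A) :
    imFun K χ (x - y) = imFun K χ x * reFun K χ y - reFun K χ x * imFun K χ y := by
  rw [sub_eq_add_neg, imFun_add, reFun_neg, imFun_neg]; ring

/-- A character is its own inverse exactly when it is real. -/
theorem eq_neg_iff_imFun_eq_zero : χ = -χ ↔ imFun K χ = 0 := by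
  constructor
  · intro h
    have h1 := imFun_char_neg K χ
    rw [← h] at h1
    exact self_eq_neg.mp h1
  · intro h
    ext x
    rw [AddChar.neg_apply, AddChar.map_neg_eq_conj, eq_comm, Complex.conj_eq_iff_im]
    exact RCLike.ofReal_eq_zero.mp (congrFun h x)

theorem reFun_mul_self_of_eq_neg (h : χ = -χ) (x : A) : reFun K χ x * reFun K χ x = 1 := by
  have h0 := reFun_sub K χ x x
  rw [(eq_neg_iff_imFun_eq_zero K χ).mp h, sub_self, reFun_zero] at h0
  simpa using h0.symm

end parts

/-- The rotations by the values of a character together with a reflection: the representation of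
`Dih(A)` of degree two induced from `χ`, in a form that is defined over the reals. -/
noncomputable def rotRep [Finite A] (χ : AddChar A ℂ) : Representation K (Dih A) (Fin 2 → K) :=
  lift (fun a => Matrix.toLin' !![reFun K χ a, -imFun K χ a; imFun K χ a, reFun K χ a])
    (Matrix.toLin' !![1, 0; 0, -1])
    (by
      simp only [reFun_zero, imFun_zero, neg_zero]
      rw [← Matrix.one_fin_two, Matrix.toLin'_one]; rfl)
    (fun a b => by
      change _ = _ ∘ₗ _
      rw [← Matrix.toLin'_mul, Matrix.mul_fin_two, reFun_add, imFun_add]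
      congr 3 <;> ring_nf)
    (by
      change _ ∘ₗ _ = _
      rw [← Matrix.toLin'_mul, Matrix.mul_fin_two]
      simp only [mul_one, mul_zero, add_zero, zero_add, neg_mul_neg, zero_mul]
      rw [← Matrix.one_fin_two, Matrix.toLin'_one]; rfl)
    (fun a => by
      change _ ∘ₗ _ = _ ∘ₗ _
      rw [← Matrix.toLin'_mul, ← Matrix.toLin'_mul, Matrix.mul_fin_two, Matrix.mul_fin_two,
        reFun_neg, imFun_neg]
      simp)

section rotRep

variable [Finite A] (χ : AddChar A ℂ)

theorem rotRep_r (a : A) : rotRep K χ (Dih.r a) =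
    Matrix.toLin' !![reFun K χ a, -imFun K χ a; imFun K χ a, reFun K χ a] := by
  simp [rotRep]

theorem rotRep_s : rotRep K χ Dih.s = Matrix.toLin' !![1, 0; 0, -1] := by
  simp [rotRep]

theorem rotRep_r_apply (a : A) (v : Fin 2 → K) : rotRep K χ (Dih.r a) v =
    ![reFun K χ a * v 0 - imFun K χ a * v 1, imFun K χ a * v 0 + reFun K χ a * v 1] := by
  rw [rotRep_r, Matrix.toLin'_apply]
  ext i
  fin_cases i <;> simp [Matrix.mulVec, dotProduct, Fin.sum_univ_two, sub_eq_add_neg]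

theorem rotRep_s_apply (v : Fin 2 → K) : rotRep K χ Dih.s v = ![v 0, -v 1] := by
  rw [rotRep_s, Matrix.toLin'_apply]
  ext i
  fin_cases i <;> simp [Matrix.mulVec, dotProduct, Fin.sum_univ_two]

/-- The reflection splits an invariant subspace into its intersections with the coordinate axes, and
a rotation by an angle that is not a multiple of `π` maps neither axis to itself. -/
theorem eq_bot_or_eq_top_of_rotRep_invariant (hχ : χ ≠ -χ) (W : Submodule K (Fin 2 → K))
    (hW : ∀ d, ∀ v ∈ W, rotRep K χ d v ∈ W) : W = ⊥ ∨ W = ⊤ := by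
  obtain ⟨a, ha⟩ : ∃ a, imFun K χ a ≠ 0 := by
    by_contra! h
    exact hχ ((eq_neg_iff_imFun_eq_zero K χ).mpr (funext h))
  have h2 : (2 : K) ≠ 0 := two_ne_zero
  have hfst : ∀ v ∈ W, ![v 0, 0] ∈ W := fun v hv => by
    have h := W.smul_mem (2⁻¹ : K) (W.add_mem hv (hW Dih.s v hv))
    rw [rotRep_s_apply] at h
    convert h using 1
    ext i
    fin_cases i
    · change v 0 = 2⁻¹ * (v 0 + v 0)
      rw [← two_mul, inv_mul_cancel_left₀ h2]
    · change 0 = 2⁻¹ * (v 1 + -v 1)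
      rw [add_neg_cancel, mul_zero]
  have hsnd : ∀ v ∈ W, ![0, v 1] ∈ W := fun v hv => by
    have h := W.sub_mem hv (hfst v hv)
    convert h using 1
    ext i
    fin_cases i
    · exact (sub_self (v 0)).symm
    · exact (sub_zero (v 1)).symm
  have key : ![(1 : K), 0] ∈ W → ![(0 : K), 1] ∈ W → W = ⊤ := fun h0 h1 => by
    refine eq_top_iff.mpr fun v _ => ?_
    have h := W.add_mem (W.smul_mem (v 0) h0) (W.smul_mem (v 1) h1)
    convert h using 1
    ext i
    fin_cases i <;> simp
  by_cases hbot : W = ⊥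
  · exact Or.inl hbot
  right
  obtain ⟨v, hv, hv0⟩ := Submodule.exists_mem_ne_zero_of_ne_bot hbot
  by_cases h0 : v 0 = 0
  · have h1 : v 1 ≠ 0 := fun h1 => hv0 (by ext i; fin_cases i <;> simp [h0, h1])
    have e1 : ![(0 : K), 1] ∈ W := by
      have h := W.smul_mem (v 1)⁻¹ (hsnd v hv)
      simpa [h1] using h
    refine key ?_ e1
    have h := W.smul_mem (-(imFun K χ a)⁻¹) (hfst _ (hW (Dih.r a) _ e1))
    rw [rotRep_r_apply] at h
    simpa [ha] using h
  · have e0 : ![(1 : K), 0] ∈ W := by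
      have h := W.smul_mem (v 0)⁻¹ (hfst v hv)
      simpa [h0] using h
    refine key e0 ?_
    have h := W.smul_mem ((imFun K χ a)⁻¹) (hsnd _ (hW (Dih.r a) _ e0))
    rw [rotRep_r_apply] at h
    simpa [ha] using h

theorem rotRep_isIrreducible (hχ : χ ≠ -χ) : (rotRep K χ).IsIrreducible where
  exists_pair_ne := by
    refine ⟨⊥, ⊤, fun h => ?_⟩
    have h1 : (⊥ : Submodule K (Fin 2 → K)) = ⊤ := congrArg Subrepresentation.toSubmodule h
    exact bot_ne_top h1
  eq_bot_or_eq_top W := by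
    rcases eq_bot_or_eq_top_of_rotRep_invariant K χ hχ W.toSubmodule
      (fun d v hv => W.apply_mem_toSubmodule d hv) with h | h
    · exact Or.inl (Subrepresentation.toSubmodule_injective h)
    · exact Or.inr (Subrepresentation.toSubmodule_injective h)

/-- Equivalent representations have equal traces `2 Re χ = 2 Re η`, and `χ + χ⁻¹` determines the
pair `{χ, χ⁻¹}` by the orthogonality of characters. -/
theorem eq_or_eq_neg_of_rotRep_equiv {η : AddChar A ℂ}
    (h : Nonempty ((rotRep K χ).Equiv (rotRep K η))) : η = χ ∨ η = -χ := by
  obtain ⟨L⟩ := h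
  have hre : ∀ x, (χ x).re = (η x).re := fun x => by
    have h1 : rotRep K η (Dih.r x) = L.toLinearEquiv.conj (rotRep K χ (Dih.r x)) := by
      refine LinearMap.ext fun v => ?_
      rw [LinearEquiv.conj_apply]
      have h2 := LinearMap.congr_fun (L.isIntertwining' (Dih.r x)) (L.toLinearEquiv.symm v)
      have h3 : L.toLinearEquiv (L.toLinearEquiv.symm v) = v := L.toLinearEquiv.apply_symm_apply v
      simp only [LinearMap.comp_apply] at h2 ⊢
      exact (congrArg _ h3.symm).trans h2.symm
    have h2 := congrArg (LinearMap.trace K _) h1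
    rw [LinearMap.trace_conj', rotRep_r, rotRep_r, Matrix.trace_toLin'_eq,
      Matrix.trace_toLin'_eq, Matrix.trace_fin_two, Matrix.trace_fin_two] at h2
    simp only [Matrix.of_apply, Matrix.cons_val', Matrix.cons_val_zero, Matrix.cons_val_one,
      Matrix.cons_val_fin_one, reFun, ← two_mul] at h2
    exact (RCLike.ofReal_inj.mp (mul_left_cancel₀ two_ne_zero h2)).symm
  by_contra! hne
  have := Fintype.ofFinite A
  have hsum : ∑ x, (χ - χ) x + ∑ x, (-χ - χ) x = ∑ x, (η - χ) x + ∑ x, (-η - χ) x := by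
    rw [← Finset.sum_add_distrib, ← Finset.sum_add_distrib]
    refine Finset.sum_congr rfl fun x _ => ?_
    simp only [AddChar.sub_apply, AddChar.neg_apply, AddChar.map_neg_eq_conj]
    rw [← add_mul, ← add_mul, Complex.add_conj, Complex.add_conj, hre]
  have hne' : -η - χ ≠ 0 := sub_ne_zero.mpr fun h => hne.2 (by rw [← h, neg_neg])
  classical
  rw [AddChar.sum_eq_ite, AddChar.sum_eq_ite, AddChar.sum_eq_ite, AddChar.sum_eq_ite,
    if_pos (by simp),
    if_neg (sub_ne_zero.mpr hne.1),
    if_neg hne'] at hsum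
  have hcard : (Fintype.card A : ℂ) ≠ 0 := Nat.cast_ne_zero.mpr Fintype.card_ne_zero
  split_ifs at hsum
  · rw [add_zero, ← two_mul] at hsum
    exact mul_ne_zero two_ne_zero hcard hsum
  · rw [add_zero, add_zero] at hsum
    exact hcard hsum

end rotRep

section rotMap

variable {V : Type*} [AddCommGroup V] [Module K V]

/-- The linear map that sends the two standard basis vectors to `p` and `q`. -/
def rotMap (p q : V) : (Fin 2 → K) →ₗ[K] V :=
  (LinearMap.proj 0).smulRight p + (LinearMap.proj 1).smulRight q

theorem rotMap_apply (p q : V) (v : Fin 2 → K) : rotMap K p q v = v 0 • p + v 1 • q := rfl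

theorem rotMap_intertwines [Finite A] (χ : AddChar A ℂ) (σ : Representation K (Dih A) V) {p q : V}
    (hp : ∀ a, σ (Dih.r a) p = reFun K χ a • p + imFun K χ a • q)
    (hq : ∀ a, σ (Dih.r a) q = reFun K χ a • q - imFun K χ a • p)
    (hsp : σ Dih.s p = p) (hsq : σ Dih.s q = -q) (d : Dih A) :
    ∀ v, rotMap K p q (rotRep K χ d v) = σ d (rotMap K p q v) := by
  refine induction (p := fun d => ∀ v, rotMap K p q (rotRep K χ d v) = σ d (rotMap K p q v))
    ?_ ?_ ?_ d
  · intro a v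
    rw [rotRep_r_apply, rotMap_apply, rotMap_apply, map_add, map_smul, map_smul, hp, hq]
    simp only [Matrix.cons_val_zero, Matrix.cons_val_one]
    module
  · intro v
    rw [rotRep_s_apply, rotMap_apply, rotMap_apply, map_add, map_smul, map_smul, hsp, hsq]
    simp
  · intro x y hx hy v
    rw [map_mul, map_mul, Module.End.mul_apply, Module.End.mul_apply, hx, hy]

end rotMap

/-! ### Spans of real and imaginary parts of characters -/

section charMap

variable (χ : AddChar A ℂ)

/-- The map of `K²` to the functions on `A` whose range is spanned by the real and the imaginary
part of `χ`. -/
noncomputable def charMap : (Fin 2 → K) →ₗ[K] (A → K) := rotMap K (reFun K χ) (imFun K χ)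

theorem charMap_apply (v : Fin 2 → K) (x : A) :
    charMap K χ v x = v 0 * reFun K χ x + v 1 * imFun K χ x := rfl

variable [Finite A]

theorem funRep_r_reFun (a : A) : funRep A K (Dih.r a) (reFun K χ) =
    reFun K χ a • reFun K χ + imFun K χ a • imFun K χ := by
  ext x
  simp [reFun_sub, mul_comm]

theorem funRep_r_imFun (a : A) : funRep A K (Dih.r a) (imFun K χ) =
    reFun K χ a • imFun K χ - imFun K χ a • reFun K χ := by
  ext x
  simp [imFun_sub, mul_comm]

theorem funRep_s_reFun : funRep A K Dih.s (reFun K χ) = reFun K χ := by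
  ext x
  simp [reFun_neg]

theorem funRep_s_imFun : funRep A K Dih.s (imFun K χ) = -imFun K χ := by
  ext x
  simp [imFun_neg]

theorem charMap_intertwines (d : Dih A) (v : Fin 2 → K) :
    charMap K χ (rotRep K χ d v) = funRep A K d (charMap K χ v) :=
  rotMap_intertwines K χ (funRep A K) (funRep_r_reFun K χ) (funRep_r_imFun K χ)
    (funRep_s_reFun K χ) (funRep_s_imFun K χ) d v

theorem charMap_injective (hχ : χ ≠ -χ) : Function.Injective (charMap K χ) := by
  rw [injective_iff_map_eq_zero]
  intro v hv
  have h0 := congrFun hv 0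
  rw [charMap_apply, reFun_zero, imFun_zero] at h0
  simp only [mul_one, mul_zero, add_zero, Pi.zero_apply] at h0
  obtain ⟨a, ha⟩ : ∃ a, imFun K χ a ≠ 0 := by
    by_contra! h
    exact hχ ((eq_neg_iff_imFun_eq_zero K χ).mpr (funext h))
  have h1 := congrFun hv a
  rw [charMap_apply, h0] at h1
  simp only [zero_mul, zero_add, Pi.zero_apply, mul_eq_zero, ha, or_false] at h1
  ext i
  fin_cases i
  exacts [h0, h1]

theorem range_charMap_neg : LinearMap.range (charMap K (-χ)) = LinearMap.range (charMap K χ) := by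
  have key : ∀ η : AddChar A ℂ,
      LinearMap.range (charMap K (-η)) ≤ LinearMap.range (charMap K η) := by
    rintro η _ ⟨v, rfl⟩
    refine ⟨![v 0, -v 1], ?_⟩
    ext x
    simp [charMap_apply, reFun_char_neg, imFun_char_neg]
  refine le_antisymm (key χ) ?_
  simpa using key (-χ)

/-- Orthogonality of characters writes each delta function as a combination of the real and
imaginary parts of characters. -/
theorem iSup_range_charMap : ⨆ χ : AddChar A ℂ, LinearMap.range (charMap K χ) = ⊤ := by
  classical
  have := Fintype.ofFinite A
  have hcard : (Fintype.card A : K) ≠ 0 := Nat.cast_ne_zero.mpr Fintype.card_ne_zero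
  have hdelta : ∀ x : A, Pi.single x (1 : K) = ∑ χ : AddChar A ℂ, charMap K χ
      ![(Fintype.card A : K)⁻¹ * reFun K χ x, (Fintype.card A : K)⁻¹ * imFun K χ x] := by
    intro x
    ext y
    have h := congrArg (fun z : ℂ => ((z.re : ℝ) : K)) (AddChar.sum_apply_eq_ite (y - x))
    simp only [Complex.re_sum, map_sum] at h
    rw [Finset.sum_apply]
    have h1 : ∀ χ : AddChar A ℂ, charMap K χ
        ![(Fintype.card A : K)⁻¹ * reFun K χ x, (Fintype.card A : K)⁻¹ * imFun K χ x] y =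
        (Fintype.card A : K)⁻¹ * (((χ (y - x)).re : ℝ) : K) := by
      intro χ
      change _ = _ * reFun K χ (y - x)
      rw [reFun_sub, charMap_apply]
      simp only [Matrix.cons_val_zero, Matrix.cons_val_one]
      ring
    rw [Finset.sum_congr rfl fun χ _ => h1 χ, ← Finset.mul_sum, h, Pi.single_apply]
    by_cases hxy : y = x
    · simp [hxy, hcard]
    · simp [hxy, sub_eq_zero]
  refine eq_top_iff.mpr fun f _ => ?_
  have hf : f = ∑ x, f x • Pi.single x (1 : K) := by
    ext y
    simp [Finset.sum_apply, Pi.single_apply]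
  rw [hf]
  refine Submodule.sum_mem _ fun x _ => Submodule.smul_mem _ _ ?_
  rw [hdelta]
  exact Submodule.sum_mem _ fun χ _ => Submodule.mem_iSup_of_mem χ ⟨_, rfl⟩

end charMap

end Dih

/-! ### Classification of the irreducible representations of degree two -/

namespace Dih

variable {A : Type*} [AddCommGroup A] (K : Type*) [RCLike K]

/-- An involution of a nonzero space has an eigenvector, with eigenvalue `1` or `-1`. -/
theorem exists_eigenvector_s {V : Type*} [AddCommGroup V] [Module K V] [Nontrivial V]
    (σ : Representation K (Dih A) V) :
    ∃ v : V, v ≠ 0 ∧ (σ Dih.s v = v ∨ σ Dih.s v = -v) := by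
  obtain ⟨v, hv⟩ := exists_ne (0 : V)
  have hss : σ Dih.s (σ Dih.s v) = v := by
    rw [← Module.End.mul_apply, ← map_mul, s_mul_s, map_one, Module.End.one_apply]
  by_cases h : v + σ Dih.s v = 0
  · exact ⟨v, hv, Or.inr (by rw [eq_neg_iff_add_eq_zero, add_comm, h])⟩
  · exact ⟨_, h, Or.inl (by rw [map_add, hss, add_comm])⟩

variable [Finite A]

/-- An eigenvector `v` of `s` gives a map `f ↦ ∑ f(x) r(x) v` from the functions on `A`; it is
nonzero on the real or on the imaginary part of some character `χ`. If `χ` is real, this produces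
an invariant line; otherwise Schur's lemma applies. For the eigenvalue `-1` the two coordinates
have to be exchanged. -/
theorem exists_rotRep_equiv (σ : Representation K (Dih A) (Fin 2 → K)) (hσ : σ.IsIrreducible) :
    ∃ χ : AddChar A ℂ, χ ≠ -χ ∧ Nonempty ((rotRep K χ).Equiv σ) := by
  classical
  have := Fintype.ofFinite A
  obtain ⟨v, hv, hsv⟩ := exists_eigenvector_s K σ
  let F : (A → K) →ₗ[K] (Fin 2 → K) :=
    Fintype.linearCombination K fun x => σ (Dih.r x) v
  have hF : ∀ f, F f = ∑ x, f x • σ (Dih.r x) v := fun f => rfl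
  have hFr : ∀ a f, σ (Dih.r a) (F f) = F (funRep A K (Dih.r a) f) := by
    intro a f
    rw [hF, hF, map_sum, ← Equiv.sum_comp (Equiv.addLeft a)
      fun x => funRep A K (Dih.r a) f x • σ (Dih.r x) v]
    refine Finset.sum_congr rfl fun x _ => ?_
    rw [map_smul, ← Module.End.mul_apply, ← map_mul, ← r_add]
    simp
  have hFs : ∀ ε : K, σ Dih.s v = ε • v → ∀ f,
      σ Dih.s (F f) = ε • F (funRep A K Dih.s f) := by
    intro ε hε f
    rw [hF, hF, map_sum, ← Equiv.sum_comp (Equiv.neg A), Finset.smul_sum]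
    refine Finset.sum_congr rfl fun x _ => ?_
    rw [map_smul, ← Module.End.mul_apply, ← map_mul, s_mul_r, map_mul, Module.End.mul_apply, hε,
      map_smul, smul_comm]
    simp
  obtain ⟨χ, hχ⟩ : ∃ χ : AddChar A ℂ, ¬ (F (reFun K χ) = 0 ∧ F (imFun K χ) = 0) := by
    by_contra! h
    have h1 : (⊤ : Submodule K (A → K)) ≤ LinearMap.ker F := by
      rw [← iSup_range_charMap K]
      refine iSup_le fun χ => ?_
      rintro _ ⟨w, rfl⟩
      change F (w 0 • reFun K χ + w 1 • imFun K χ) = 0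
      rw [map_add, map_smul, map_smul, (h χ).1, (h χ).2, smul_zero, smul_zero, add_zero]
    have h2 : F (Pi.single 0 1) = 0 := h1 Submodule.mem_top
    rw [Fintype.linearCombination_apply_single, r_zero, map_one] at h2
    exact hv (by simpa using h2)
  have hp : ∀ a, σ (Dih.r a) (F (reFun K χ)) =
      reFun K χ a • F (reFun K χ) + imFun K χ a • F (imFun K χ) := fun a => by
    rw [hFr, funRep_r_reFun, map_add, map_smul, map_smul]
  have hq : ∀ a, σ (Dih.r a) (F (imFun K χ)) =
      reFun K χ a • F (imFun K χ) - imFun K χ a • F (reFun K χ) := fun a => by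
    rw [hFr, funRep_r_imFun, map_sub, map_smul, map_smul]
  by_cases hreal : χ = -χ
  · exfalso
    have him : imFun K χ = 0 := (eq_neg_iff_imFun_eq_zero K χ).mp hreal
    have hp0 : F (reFun K χ) ≠ 0 := fun h => hχ ⟨h, by rw [him, map_zero]⟩
    -- the line spanned by `F (reFun K χ)` is invariant
    have hline : ∀ d, ∀ w ∈ Submodule.span K {F (reFun K χ)},
        σ d w ∈ Submodule.span K {F (reFun K χ)} := by
      refine induction (fun a w hw => ?_) (fun w hw => ?_) fun x y hx hy w hw => ?_
      · obtain ⟨t, rfl⟩ := Submodule.mem_span_singleton.mp hw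
        rw [map_smul, hp, him]
        refine Submodule.smul_mem _ _ ?_
        simpa using Submodule.smul_mem _ _ (Submodule.mem_span_singleton_self _)
      · obtain ⟨t, rfl⟩ := Submodule.mem_span_singleton.mp hw
        rw [map_smul]
        refine Submodule.smul_mem _ _ ?_
        rcases hsv with h | h
        · rw [hFs 1 (by rw [h, one_smul]), funRep_s_reFun, one_smul]
          exact Submodule.mem_span_singleton_self _
        · rw [hFs (-1) (by rw [h, neg_one_smul]), funRep_s_reFun]
          exact Submodule.smul_mem _ _ (Submodule.mem_span_singleton_self _)
      · rw [map_mul]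
        exact hx _ (hy _ hw)
    have hfin := finrank_span_singleton (K := K) hp0
    rcases hσ.eq_bot_or_eq_top ⟨_, hline⟩ with h | h
    · have h' : Submodule.span K {F (reFun K χ)} = ⊥ := congrArg Subrepresentation.toSubmodule h
      rw [h', finrank_bot] at hfin
      exact absurd hfin (by norm_num)
    · have h' : Submodule.span K {F (reFun K χ)} = ⊤ := congrArg Subrepresentation.toSubmodule h
      rw [h', finrank_top, Module.finrank_fin_fun] at hfin
      exact absurd hfin (by norm_num)
  refine ⟨χ, hreal, ?_⟩
  have hirr := rotRep_isIrreducible K χ hreal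
  -- Schur's lemma for the map with values `p` and `q` on the standard basis vectors
  have schur : ∀ p q, (∀ a, σ (Dih.r a) p = reFun K χ a • p + imFun K χ a • q) →
      (∀ a, σ (Dih.r a) q = reFun K χ a • q - imFun K χ a • p) →
      σ Dih.s p = p → σ Dih.s q = -q → ¬ (p = 0 ∧ q = 0) →
      Nonempty ((rotRep K χ).Equiv σ) := by
    intro p q h1 h2 h3 h4 h5
    let f : (rotRep K χ).IntertwiningMap σ :=
      ⟨rotMap K p q, fun d => LinearMap.ext fun w => rotMap_intertwines K χ σ h1 h2 h3 h4 d w⟩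
    rcases Representation.IsIrreducible.bijective_or_eq_zero f with h | h
    · exact ⟨f.ofBijective h⟩
    · refine absurd ⟨?_, ?_⟩ h5
      · have : rotMap K p q ![1, 0] = 0 := congrArg (fun g => g ![1, 0]) h
        simpa [rotMap_apply] using this
      · have : rotMap K p q ![0, 1] = 0 := congrArg (fun g => g ![0, 1]) h
        simpa [rotMap_apply] using this
  rcases hsv with h | h
  · have hs := hFs 1 (by rw [h, one_smul])
    exact schur _ _ hp hq (by rw [hs, funRep_s_reFun, one_smul])
      (by rw [hs, funRep_s_imFun, one_smul, map_neg]) hχ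
  · have hs := hFs (-1) (by rw [h, neg_one_smul])
    refine schur (F (imFun K χ)) (-F (reFun K χ)) (fun a => ?_) (fun a => ?_) ?_ ?_ ?_
    · rw [hq, smul_neg, sub_eq_add_neg]
    · rw [map_neg, hp]
      module
    · rw [hs, funRep_s_imFun, map_neg, neg_one_smul, neg_neg]
    · rw [map_neg, hs, funRep_s_reFun, neg_one_smul]
    · exact fun h => hχ ⟨neg_eq_zero.mp h.2, h.1⟩

/-- The representation of `χ` depends only on the pair `{χ, χ⁻¹}`. -/
theorem rotRep_neg_equiv (χ : AddChar A ℂ) :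
    Nonempty ((rotRep K (-χ)).Equiv (rotRep K χ)) := by
  have hr : ∀ η : AddChar A ℂ, rotMap K ![1, 0] ![0, -1] ∘ₗ rotMap K ![1, 0] ![0, -1] =
      LinearMap.id (M := Fin 2 → K) := fun η => by
    refine LinearMap.ext fun v => ?_
    ext i
    fin_cases i <;> simp [rotMap_apply]
  refine ⟨Representation.Equiv.mk (LinearEquiv.ofLinearMap _ _ (hr χ) (hr χ)) fun d => ?_⟩
  refine LinearMap.ext fun v => rotMap_intertwines K (-χ) (rotRep K χ) ?_ ?_ ?_ ?_ d v
  · intro a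
    rw [rotRep_r_apply, reFun_char_neg, imFun_char_neg]
    ext i
    fin_cases i <;> simp
  · intro a
    rw [rotRep_r_apply, reFun_char_neg, imFun_char_neg]
    ext i
    fin_cases i <;> simp
  · rw [rotRep_s_apply]; simp
  · rw [rotRep_s_apply]; simp

/-! ### Characters that are trivial on `s` -/

/-- The extension of a real character of `A` to `Dih(A)` with value `1` at `s`. -/
noncomputable def realChar (χ : AddChar A ℂ) (h : χ = -χ) : Dih A →* Kˣ :=
  lift (fun a => ⟨reFun K χ a, reFun K χ a, reFun_mul_self_of_eq_neg K χ h a,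
      reFun_mul_self_of_eq_neg K χ h a⟩) 1
    (Units.ext (reFun_zero K χ))
    (fun a b => Units.ext (by
      simp [reFun_add, (eq_neg_iff_imFun_eq_zero K χ).mp h]))
    (one_mul 1)
    (fun a => Units.ext (by simp [reFun_neg]))

@[simp]
theorem realChar_r (χ : AddChar A ℂ) (h : χ = -χ) (a : A) :
    (realChar K χ h (Dih.r a) : K) = reFun K χ a := by
  simp [realChar]

@[simp]
theorem realChar_s (χ : AddChar A ℂ) (h : χ = -χ) : realChar K χ h Dih.s = 1 := by
  simp [realChar]

theorem realChar_injective {χ η : AddChar A ℂ} (hχ : χ = -χ) (hη : η = -η)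
    (h : realChar K χ hχ = realChar K η hη) : χ = η := by
  ext x
  have h1 : reFun K χ x = reFun K η x := by
    rw [← realChar_r K χ hχ, ← realChar_r K η hη, h]
  have h2 : imFun ℝ χ x = imFun ℝ η x := by
    rw [(eq_neg_iff_imFun_eq_zero ℝ χ).mp hχ, (eq_neg_iff_imFun_eq_zero ℝ η).mp hη]
  exact Complex.ext (RCLike.ofReal_inj.mp h1) h2

/-- A character with value `1` at `s` has `χ(a) = χ(a)⁻¹`, hence takes the values `1` and `-1`
only. -/
theorem exists_realChar_eq (χ : Dih A →* Kˣ) (hχ : χ Dih.s = 1) :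
    ∃ η : AddChar A ℂ, ∃ h : η = -η, realChar K η h = χ := by
  have hneg : ∀ a, χ (Dih.r (-a)) = χ (Dih.r a) := fun a => by
    have h := congrArg χ (s_mul_r a)
    rw [map_mul, map_mul, hχ, one_mul, mul_one] at h
    exact h.symm
  have hpm : ∀ a, (χ (Dih.r a) : K) = 1 ∨ (χ (Dih.r a) : K) = -1 := fun a => by
    have h : χ (Dih.r a) * χ (Dih.r (-a)) = 1 := by
      rw [← map_mul, ← r_add, add_neg_cancel, r_zero, map_one]
    rw [hneg] at h
    exact mul_self_eq_one_iff.mp (by simpa using congrArg Units.val h)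
  have hmul : ∀ a b, RCLike.re (χ (Dih.r (a + b)) : K) =
      RCLike.re (χ (Dih.r a) : K) * RCLike.re (χ (Dih.r b) : K) := fun a b => by
    rw [r_add, map_mul, Units.val_mul]
    rcases hpm a with h | h <;> rw [h] <;> simp
  let η : AddChar A ℂ :=
    { toFun := fun a => ((RCLike.re (χ (Dih.r a) : K) : ℝ) : ℂ)
      map_zero_eq_one' := by simp [r_zero]
      map_add_eq_mul' := fun a b => by rw [hmul, Complex.ofReal_mul] }
  have hη : ∀ a, η a = ((RCLike.re (χ (Dih.r a) : K) : ℝ) : ℂ) := fun a => rfl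
  refine ⟨η, ?_, hom_ext (fun a => Units.ext ?_) ?_⟩
  · ext a
    rw [AddChar.neg_apply, hη, hη, hneg]
  · rw [realChar_r, reFun, hη, Complex.ofReal_re]
    rcases hpm a with h | h <;> rw [h] <;> simp
  · rw [realChar_s, hχ]

end Dih

/-! ### Choosing one element out of each pair, and direct sums by dimension -/

/-- The elements of a finite set with an involution that are not fixed can be split into a set and
its image under the involution. -/
theorem exists_transversal_neg (X : Type*) [Finite X] [InvolutiveNeg X] :
    ∃ P : Set X, (∀ x ∈ P, x ≠ -x) ∧ (∀ x, x ≠ -x → x ∈ P ∨ -x ∈ P) ∧ (∀ x ∈ P, -x ∉ P) ∧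
      Nat.card X = Nat.card {x : X // x = -x} + 2 * Nat.card P := by
  obtain ⟨n, ⟨i⟩⟩ := Finite.exists_equiv_fin X
  -- the linear order of `Fin n` chooses one of `x` and `-x`
  refine ⟨{x | i x < i (-x)}, fun x hx h => ?_, fun x hx => ?_, fun x hx hx' => ?_, ?_⟩
  · rw [Set.mem_ofPred_eq, ← h] at hx
    exact lt_irrefl _ hx
  · rcases lt_or_gt_of_ne (fun h => hx (i.injective h) : i x ≠ i (-x)) with h | h
    · exact Or.inl h
    · exact Or.inr (by rwa [Set.mem_ofPred_eq, neg_neg])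
  · rw [Set.mem_ofPred_eq, neg_neg] at hx'
    exact lt_asymm hx hx'
  · have e : {x : X // ¬ x = -x} ≃ {x : X // i x < i (-x)} ⊕ {x : X // i (-x) < i x} :=
      (Equiv.subtypeEquivRight fun x => by
        rw [← i.injective.eq_iff, ← Ne, ne_iff_lt_or_gt]).trans
        (subtypeOrEquiv _ _ (Pi.disjoint_iff.mpr fun x => by
          rw [Prop.disjoint_iff]
          exact fun h => lt_asymm h.1 h.2))
    have e' : {x : X // i (-x) < i x} ≃ {x : X // i x < i (-x)} :=
      (Equiv.neg X).subtypeEquiv fun x => by simp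
    classical
    rw [← Nat.card_congr (Equiv.sumCompl fun x : X => x = -x), Nat.card_sum, Nat.card_congr e,
      Nat.card_sum, Nat.card_congr e', two_mul]
    rfl

/-- A finite family of subspaces that spans the whole space and whose dimensions add up to the
dimension of the space is a direct decomposition. -/
theorem isDirectSumOf_of_iSup_eq_top {ι K M : Type*} [Field K] [AddCommGroup M] [Module K M]
    [Fintype ι] [FiniteDimensional K M] (W : ι → Submodule K M) (hW : ⨆ i, W i = ⊤)
    (hdim : ∑ i, Module.finrank K (W i) = Module.finrank K M) : IsDirectSumOf W := by
  classical
  have hsurj : Function.Surjective (DirectSum.coeLinearMap W) := by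
    rw [← LinearMap.range_eq_top, DirectSum.range_coeLinearMap, hW]
  have : DirectSum.IsInternal W :=
    ⟨(LinearMap.injective_iff_surjective_of_finrank_eq_finrank
      (by rw [Module.finrank_directSum, hdim])).mpr hsurj, hsurj⟩
  unfold IsDirectSumOf
  convert this

/-! ### Orbits of a Takasaki quandle -/

namespace Takasaki

variable {H : Type*}

/-- An element of `H` as an element of the Takasaki quandle. -/
def mk (x : H) : Takasaki H := x

/-- An element of the Takasaki quandle as an element of `H`. -/
def val (x : Takasaki H) : H := x

theorem mk_val (x : Takasaki H) : mk (val x) = x := rfl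

theorem val_mk (x : H) : val (mk x) = x := rfl

variable [AddCommGroup H]

theorem inn_apply_sub_mem_twice (g : Equiv.Perm (Takasaki H)) (hg : g ∈ Inn (Takasaki H)) :
    ∀ y, val (g y) - val y ∈ twice H := by
  induction hg using Subgroup.closure_induction with
  | mem g hg =>
    obtain ⟨b, rfl⟩ := hg
    intro y
    refine ⟨val b - val y, ?_⟩
    change 2 • (val b - val y) = (2 • val b - val y) - val y
    module
  | one => exact fun y => by simp
  | mul g h _ _ hg hh =>
    intro y
    simpa using (twice H).add_mem (hg (h y)) (hh y)
  | inv g _ hg =>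
    intro y
    have h := (twice H).neg_mem (hg (g⁻¹ y))
    rw [show g (g⁻¹ y) = y from g.apply_symm_apply y, neg_sub] at h
    exact h

theorem mem_orbit_iff (x y : Takasaki H) :
    x ∈ MulAction.orbit (Inn (Takasaki H)) y ↔ val x - val y ∈ twice H := by
  constructor
  · rintro ⟨g, rfl⟩
    exact inn_apply_sub_mem_twice g.1 g.2 y
  · rintro ⟨h, hh⟩
    refine ⟨Inn.rightMul (mk (val y + h)), ?_⟩
    change 2 • h = val x - val y at hh
    change mk (2 • (val y + h) - val y) = x
    rw [smul_add, hh, ← mk_val x]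
    congr 1
    rw [val_mk]
    module

theorem mk_eq_mk_iff (x y : Takasaki H) :
    (Quotient.mk'' x : InnOrbit (Takasaki H)) = Quotient.mk'' y ↔ val x - val y ∈ twice H := by
  rw [← mem_orbit_iff, Quotient.eq'']
  exact MulAction.orbitRel_apply

theorem mem_innOrbit_iff {ω : InnOrbit (Takasaki H)} {a : H} (ha : mk a ∈ ω.orbit)
    (x : Takasaki H) : x ∈ ω.orbit ↔ val x - a ∈ twice H := by
  rw [MulAction.orbitRel.Quotient.mem_orbit] at ha ⊢
  rw [← ha]
  exact mk_eq_mk_iff x (mk a)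

variable (H) in
/-- The orbits are the cosets of `2H`, and `|H/2H|` is the number of elements of `H` killed by
`2`. -/
theorem card_innOrbit [Finite H] :
    Nat.card (InnOrbit (Takasaki H)) = Nat.card {x : H // 2 • x = 0} := by
  have e : InnOrbit (Takasaki H) ≃ H ⧸ twice H := by
    refine Quotient.congr ⟨val, mk, mk_val, val_mk⟩ fun x y => ?_
    refine (MulAction.orbitRel_apply.trans (mem_orbit_iff x y)).trans ?_
    refine Iff.trans ?_ (QuotientAddGroup.leftRel_apply (s := twice H)).symm
    rw [← neg_mem_iff, neg_sub, sub_eq_add_neg, add_comm]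
    rfl
  rw [Nat.card_congr e]
  have h1 := AddSubgroup.card_eq_card_quotient_mul_card_addSubgroup (twice H)
  have h2 := AddSubgroup.card_eq_card_quotient_mul_card_addSubgroup
    (nsmulAddMonoidHom (α := H) 2).ker
  rw [Nat.card_congr
    (QuotientAddGroup.quotientKerEquivRange (nsmulAddMonoidHom (α := H) 2)).toEquiv] at h2
  have h3 : 0 < Nat.card (twice H) := Nat.card_pos
  have h4 : Nat.card (nsmulAddMonoidHom (α := H) 2).ker = Nat.card {x : H // 2 • x = 0} := rfl
  rw [← h4]
  rw [h1, mul_comm] at h2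
  exact Nat.eq_of_mul_eq_mul_left h3 h2

section basePoint

variable (ω : InnOrbit (Takasaki H)) (a : H) (ha : mk a ∈ ω.orbit)

/-- The bijection `x ↦ x - a` of the orbit of `a` with `2H`. -/
def orbitEquiv : ω.orbit ≃ twice H where
  toFun x := ⟨val x.1 - a, (mem_innOrbit_iff ha x.1).mp x.2⟩
  invFun c := ⟨mk (c.1 + a), (mem_innOrbit_iff ha _).mpr (by simp [val_mk])⟩
  left_inv x := Subtype.ext (sub_add_cancel (val x.1) a)
  right_inv c := Subtype.ext (add_sub_cancel_right c.1 a)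

/-- The action of `Dih(2H)` on the orbit of `a` by `x ↦ x + c` and `x ↦ 2a - x`. -/
def dihPerm : Dih (twice H) →* Equiv.Perm ω.orbit :=
  ((orbitEquiv ω a ha).symm.permCongrHom).toMonoidHom.comp (Dih.perm (twice H))

theorem orbitEquiv_dihPerm_apply (d : Dih (twice H)) (x : ω.orbit) :
    orbitEquiv ω a ha (dihPerm ω a ha d x) = Dih.perm (twice H) d (orbitEquiv ω a ha x) := by
  simp [dihPerm]

theorem dihPerm_injective (hH : ∃ x : twice H, 2 • x ≠ 0) :
    Function.Injective (dihPerm ω a ha) :=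
  (MulEquiv.injective (orbitEquiv ω a ha).symm.permCongrHom).comp (Dih.perm_injective hH)

theorem dihPerm_r_mul_s (b : H) :
    dihPerm ω a ha (Dih.r (twice.mk (b - a)) * Dih.s) = orbitRightMul ω (mk b) := by
  ext1 x
  apply (orbitEquiv ω a ha).injective
  rw [orbitEquiv_dihPerm_apply, map_mul, Equiv.Perm.mul_apply, Dih.perm_s_apply,
    Dih.perm_r_apply]
  refine Subtype.ext ?_
  change 2 • (b - a) + -(val x.1 - a) = (2 • b - val x.1) - a
  module

theorem range_dihPerm : (dihPerm ω a ha).range = InnOn ω := by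
  have hb : ∀ b : H, Dih.r (twice.mk (b - a)) * Dih.s ∈ (InnOn ω).comap (dihPerm ω a ha) :=
    fun b => by
      rw [Subgroup.mem_comap, dihPerm_r_mul_s]
      exact Subgroup.subset_closure (Set.mem_range_self _)
  have hs : Dih.s ∈ (InnOn ω).comap (dihPerm ω a ha) := by
    have h := hb a
    rwa [show twice.mk (a - a) = 0 from Subtype.ext (by simp [twice.mk]), Dih.r_zero,
      one_mul] at h
  refine le_antisymm ?_ ?_
  · rintro _ ⟨d, rfl⟩
    change d ∈ (InnOn ω).comap (dihPerm ω a ha)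
    refine Dih.induction (fun c => ?_) hs (fun x y => Subgroup.mul_mem _) d
    obtain ⟨_, h, rfl⟩ := c
    have h1 := Subgroup.mul_mem _ (hb (h + a)) hs
    rw [mul_assoc, Dih.s_mul_s, mul_one, add_sub_cancel_right] at h1
    exact h1
  · refine (Subgroup.closure_le _).mpr ?_
    rintro _ ⟨b, rfl⟩
    exact ⟨_, dihPerm_r_mul_s ω a ha b⟩

/-- The isomorphism of `Inn(X_ω)` with `Dih(2H)` given by a base point `a` of the orbit. -/
noncomputable def innOnEquiv (hH : ∃ x : twice H, 2 • x ≠ 0) : InnOn ω ≃* Dih (twice H) :=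
  ((MonoidHom.ofInjective (dihPerm_injective ω a ha hH)).trans
    (MulEquiv.subgroupCongr (range_dihPerm ω a ha))).symm

theorem dihPerm_innOnEquiv (hH : ∃ x : twice H, 2 • x ≠ 0) (g : InnOn ω) :
    dihPerm ω a ha (innOnEquiv ω a ha hH g) = g := by
  obtain ⟨d, rfl⟩ := (innOnEquiv ω a ha hH).symm.surjective g
  rw [MulEquiv.apply_symm_apply]
  rfl

theorem innOnEquiv_rightMul (hH : ∃ x : twice H, 2 • x ≠ 0) (b : H) :
    innOnEquiv ω a ha hH (InnOn.rightMul ω (mk b)) =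
      Dih.r (twice.mk (b - a)) * Dih.s := by
  apply dihPerm_injective ω a ha hH
  rw [dihPerm_innOnEquiv, dihPerm_r_mul_s]
  rfl

variable (K : Type*) [Field K] [Finite H]

/-- The space `K[X_ω]` as the space of functions on `2H`. -/
noncomputable def funEquiv : (twice H → K) ≃ₗ[K] (ω.orbit →₀ K) :=
  have : Finite ω.orbit := Finite.of_equiv _ (orbitEquiv ω a ha).symm
  (LinearEquiv.funCongrLeft K K (orbitEquiv ω a ha)).trans
    (Finsupp.linearEquivFunOnFinite K K ω.orbit).symm

theorem funEquiv_apply (f : twice H → K) (x : ω.orbit) :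
    funEquiv ω a ha K f x = f (orbitEquiv ω a ha x) := rfl

theorem orbitRep_funEquiv (hH : ∃ x : twice H, 2 • x ≠ 0) (g : InnOn ω) (f : twice H → K) :
    QuandleRing.orbitRep K ω g (funEquiv ω a ha K f) =
      funEquiv ω a ha K (Dih.funRep (twice H) K (innOnEquiv ω a ha hH g) f) := by
  ext x
  rw [funEquiv_apply, Dih.funRep_apply]
  change Finsupp.mapDomain (g : Equiv.Perm ω.orbit) (funEquiv ω a ha K f) x = _
  rw [Finsupp.mapDomain_equiv_apply, funEquiv_apply]
  congr 1
  rw [Equiv.Perm.eq_inv_iff_eq, ← orbitEquiv_dihPerm_apply, dihPerm_innOnEquiv,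
    Equiv.apply_symm_apply]

end basePoint

end Takasaki

/-! ### Right ideals inside the span of an orbit -/

namespace QuandleRing

variable {K X : Type*} [Field K] [Quandle X]

theorem orbitIncl_injective (ω : InnOrbit X) : Function.Injective (orbitIncl K ω) :=
  Finsupp.mapDomain_injective Subtype.val_injective

/-- The multiple `α x` of a basis element `x` of the quandle ring. -/
noncomputable def single (x : X) (α : K) : QuandleRing K X := (Finsupp.single x α : X →₀ K)

theorem orbitIncl_single (ω : InnOrbit X) (x : ω.orbit) (α : K) :
    orbitIncl K ω (Finsupp.single x α) = single x.1 α :=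
  Finsupp.mapDomain_single

theorem single_mul_single (x y : X) (α β : K) :
    single x α * single y β = single (y ◃ x) (α * β) := by
  change mul (Finsupp.single x α) (Finsupp.single y β) = Finsupp.single (y ◃ x) (α * β)
  unfold mul
  rw [Finsupp.sum_single_index (by simp), Finsupp.sum_single_index (by simp)]

/-- Right multiplication by a basis element `y` is the action of `R_y`. -/
theorem orbitIncl_mul_single (ω : InnOrbit X) (u : ω.orbit →₀ K) (y : X) (β : K) :
    orbitIncl K ω u * single y β =
      β • orbitIncl K ω (orbitRep K ω (InnOn.rightMul ω y) u) := by
  induction u using Finsupp.induction_linear with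
  | zero => simp
  | add u v hu hv => rw [map_add, add_mul, hu, hv, map_add, map_add, smul_add]
  | single x α =>
    have h : orbitRep K ω (InnOn.rightMul ω y) (Finsupp.single x α) =
        Finsupp.single (orbitRightMul ω y x) α := Finsupp.mapDomain_single
    rw [h, orbitIncl_single, orbitIncl_single, single_mul_single, mul_comm]
    exact (Finsupp.smul_single β _ α).symm

/-- An invariant subspace of `K[X_ω]` is a right ideal of `K[X]`. -/
theorem isRightIdeal_map_orbitIncl (ω : InnOrbit X) (W : Submodule K (ω.orbit →₀ K))
    (hW : ∀ g, ∀ w ∈ W, orbitRep K ω g w ∈ W) : IsRightIdeal (W.map (orbitIncl K ω)) := by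
  rintro _ ⟨w, hw, rfl⟩ v
  induction v using Finsupp.induction_linear with
  | zero => exact (mul_zero (orbitIncl K ω w)).symm ▸ Submodule.zero_mem _
  | add u v hu hv => exact (mul_add (orbitIncl K ω w) u v).symm ▸ Submodule.add_mem _ hu hv
  | single y β =>
    exact (orbitIncl_mul_single ω w y β).symm ▸
      Submodule.smul_mem _ _ (Submodule.mem_map_of_mem (hW _ w hw))

/-- The part of a right ideal inside `K[X_ω]` is invariant; finiteness makes the inverses of the
right multiplications superfluous as generators. -/
theorem IsRightIdeal.comap_orbitIncl_invariant [Finite X] {J : Submodule K (QuandleRing K X)}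
    (hJ : IsRightIdeal J) (ω : InnOrbit X) (g : InnOn ω) :
    ∀ w ∈ J.comap (orbitIncl K ω), orbitRep K ω g w ∈ J.comap (orbitIncl K ω) := by
  have : Finite (Equiv.Perm ω.orbit) := inferInstance
  have hmem : g.1 ∈ Submonoid.closure (Set.range (orbitRightMul ω)) := by
    rw [← Subgroup.closure_toSubmonoid_of_finite]
    exact g.2
  have key : ∀ p : Equiv.Perm ω.orbit, p ∈ Submonoid.closure (Set.range (orbitRightMul ω)) →
      ∀ w ∈ J.comap (orbitIncl K ω), Finsupp.lmapDomain K K p w ∈ J.comap (orbitIncl K ω) := by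
    intro p hp
    induction hp using Submonoid.closure_induction with
    | mem p hp =>
      obtain ⟨y, rfl⟩ := hp
      intro w hw
      have h := hJ _ hw (single y 1)
      rw [orbitIncl_mul_single, one_smul] at h
      exact h
    | one =>
      intro w hw
      rw [show Finsupp.lmapDomain K K ((1 : Equiv.Perm ω.orbit) : ω.orbit → ω.orbit) =
        LinearMap.id from Finsupp.lmapDomain_id K K]
      exact hw
    | mul p q _ _ hp hq =>
      intro w hw
      rw [show Finsupp.lmapDomain K K ((p * q : Equiv.Perm ω.orbit) : ω.orbit → ω.orbit) =
        (Finsupp.lmapDomain K K p).comp (Finsupp.lmapDomain K K q) from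
          Finsupp.lmapDomain_comp K K q p]
      exact hp _ (hq w hw)
  exact key g.1 hmem

/-- An invariant subspace without proper nonzero invariant subspaces is a simple right ideal. -/
theorem isSimpleRightIdeal_map_orbitIncl [Finite X] (ω : InnOrbit X)
    (W : Submodule K (ω.orbit →₀ K)) (hW : ∀ g, ∀ w ∈ W, orbitRep K ω g w ∈ W) (hbot : W ≠ ⊥)
    (hmin : ∀ J : Submodule K (ω.orbit →₀ K), (∀ g, ∀ w ∈ J, orbitRep K ω g w ∈ J) → J ≤ W →
      J = ⊥ ∨ J = W) :
    IsSimpleRightIdeal (W.map (orbitIncl K ω)) := by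
  refine ⟨isRightIdeal_map_orbitIncl ω W hW, ?_, fun J hJ hJW => ?_⟩
  · exact fun h => hbot (Submodule.map_injective_of_injective (orbitIncl_injective ω)
      (h.trans (Submodule.map_bot _).symm))
  · have hle : J.comap (orbitIncl K ω) ≤ W := by
      rw [← Submodule.comap_map_eq_of_injective (orbitIncl_injective (K := K) ω) W]
      exact Submodule.comap_mono hJW
    have hJ' : (J.comap (orbitIncl K ω)).map (orbitIncl K ω) = J :=
      Submodule.map_comap_eq_of_le (hJW.trans (LinearMap.map_le_range))
    rcases hmin _ (hJ.comap_orbitIncl_invariant ω) hle with h | h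
    · exact Or.inl (by rw [← hJ', h, Submodule.map_bot])
    · exact Or.inr (by rw [← hJ', h])

instance [Finite X] : FiniteDimensional K (QuandleRing K X) :=
  inferInstanceAs (FiniteDimensional K (X →₀ K))

theorem finrank_quandleRing [Finite X] : Module.finrank K (QuandleRing K X) = Nat.card X := by
  have := Fintype.ofFinite X
  rw [Nat.card_eq_fintype_card]
  exact Module.finrank_finsupp_self K

theorem finrank_finsupp_orbit [Finite X] (ω : InnOrbit X) :
    Module.finrank K (ω.orbit →₀ K) = Nat.card ω.orbit := by
  have := Fintype.ofFinite ω.orbit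
  rw [Nat.card_eq_fintype_card]
  exact Module.finrank_finsupp_self K

variable (K X) in
theorem iSup_range_orbitIncl :
    ⨆ ω : InnOrbit X, LinearMap.range (orbitIncl K ω) = ⊤ := by
  refine eq_top_iff.mpr fun u _ => ?_
  induction u using Finsupp.induction_linear with
  | zero => exact Submodule.zero_mem _
  | add u v hu hv => exact Submodule.add_mem _ (hu trivial) (hv trivial)
  | single x α =>
    refine Submodule.mem_iSup_of_mem (Quotient.mk'' x : InnOrbit X) ?_
    exact ⟨Finsupp.single ⟨x, MulAction.orbitRel.Quotient.mem_orbit.mpr rfl⟩ α,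
      orbitIncl_single _ _ α⟩

variable (X) in
theorem sum_card_orbit [Finite X] [Fintype (InnOrbit X)] :
    ∑ ω : InnOrbit X, Nat.card ω.orbit = Nat.card X := by
  rw [Nat.card_congr (MulAction.selfEquivSigmaOrbits' (Inn X) X), Nat.card_sigma]

theorem isDirectSumOf_range_orbitIncl [Finite X] :
    IsDirectSumOf (fun ω : InnOrbit X => LinearMap.range (orbitIncl K ω)) := by
  have := Fintype.ofFinite (InnOrbit X)
  refine isDirectSumOf_of_iSup_eq_top _ (iSup_range_orbitIncl K X) ?_
  rw [finrank_quandleRing, ← sum_card_orbit]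
  refine Finset.sum_congr rfl fun ω _ => ?_
  rw [LinearMap.finrank_range_of_inj (orbitIncl_injective ω), finrank_finsupp_orbit]

/-- Decompositions of all the spaces `K[X_ω]` combine to a decomposition of `K[X]`. -/
theorem isDirectSumOf_map_orbitIncl [Finite X] {ι : Type*} [Fintype ι]
    (W : ∀ ω : InnOrbit X, ι → Submodule K (ω.orbit →₀ K)) (hW : ∀ ω, ⨆ i, W ω i = ⊤)
    (hdim : ∀ ω, ∑ i, Module.finrank K (W ω i) = Nat.card ω.orbit) :
    IsDirectSumOf (fun p : InnOrbit X × ι => (W p.1 p.2).map (orbitIncl K p.1)) := by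
  have := Fintype.ofFinite (InnOrbit X)
  refine isDirectSumOf_of_iSup_eq_top _ ?_ ?_
  · rw [iSup_prod, ← iSup_range_orbitIncl K X]
    refine iSup_congr fun ω => ?_
    change ⨆ i, (W ω i).map (orbitIncl K ω) = _
    rw [← Submodule.map_iSup, hW, Submodule.map_top]
  · rw [Fintype.sum_prod_type, finrank_quandleRing, ← sum_card_orbit]
    refine Finset.sum_congr rfl fun ω _ => ?_
    rw [← hdim ω]
    exact Finset.sum_congr rfl fun i _ =>
      LinearEquiv.finrank_eq (Submodule.equivMapOfInjective _ (orbitIncl_injective ω) _).symm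

end QuandleRing

/-! ### Elements killed by two -/

/-- A finite abelian group is isomorphic to its dual, and the real characters are those killed
by `2`. -/
theorem card_real_addChar (A : Type*) [AddCommGroup A] [Finite A] :
    Nat.card {χ : AddChar A ℂ // χ = -χ} = Nat.card {x : A // 2 • x = 0} := by
  have : NeZero (Monoid.exponent (Multiplicative A)) := ⟨Monoid.exponent_ne_zero_of_finite⟩
  obtain ⟨e⟩ := CommGroup.monoidHom_mulEquiv_of_hasEnoughRootsOfUnity (Multiplicative A) ℂ
  let E : AddChar A ℂ ≃ (Multiplicative A →* ℂˣ) :=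
    { toFun := fun χ => MonoidHom.toHomUnits χ.toMonoidHom
      invFun := fun f => AddChar.toMonoidHomEquiv.symm ((Units.coeHom ℂ).comp f)
      left_inv := fun χ => rfl
      right_inv := fun f => by ext; rfl }
  refine Nat.card_congr ((E.trans (e.toEquiv.trans Multiplicative.toAdd)).subtypeEquiv fun χ => ?_)
  have h1 : 2 • (Multiplicative.toAdd (e (E χ))) = 0 ↔ E χ ^ 2 = 1 := by
    rw [← toAdd_pow, ← map_pow, toAdd_eq_zero, map_eq_one_iff e e.injective]
  refine Iff.trans ?_ h1.symm
  rw [eq_neg_iff_add_eq_zero]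
  constructor
  · intro h
    ext x
    have h2 := DFunLike.congr_fun h (Multiplicative.toAdd x)
    rw [sq]
    exact h2
  · intro h
    ext x
    have h2 := congrArg Units.val (DFunLike.congr_fun h (Multiplicative.ofAdd x))
    rw [sq] at h2
    exact h2


namespace ZMod

theorem two_nsmul_eq_zero_iff_of_odd {m : ℕ} (hm : Odd m) (x : ZMod m) : 2 • x = 0 ↔ x = 0 := by
  have h2 : IsUnit ((2 : ℕ) : ZMod m) :=
    (ZMod.isUnit_iff_coprime 2 m).mpr (Nat.coprime_two_left.mpr hm)
  rw [nsmul_eq_mul, h2.mul_right_eq_zero]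

theorem two_nsmul_eq_zero_iff {n : ℕ} (hn : 0 < n) (x : ZMod (2 * n)) :
    2 • x = 0 ↔ x = 0 ∨ x = n := by
  have : NeZero (2 * n) := ⟨by omega⟩
  constructor
  · intro h
    rw [← ZMod.natCast_zmod_val x, nsmul_eq_mul, ← Nat.cast_mul, ZMod.natCast_eq_zero_iff] at h
    obtain ⟨c, hc⟩ := Nat.dvd_of_mul_dvd_mul_left two_pos h
    have hlt := ZMod.val_lt x
    have hc2 : c < 2 := by
      by_contra! h2
      have := Nat.mul_le_mul_left n h2
      omega
    rw [← ZMod.natCast_zmod_val x, hc]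
    interval_cases c
    · simp
    · simp
  · rintro (rfl | rfl)
    · simp
    · rw [nsmul_eq_mul, ← Nat.cast_mul, ZMod.natCast_self]

theorem half_ne_zero {n : ℕ} (hn : 0 < n) : (n : ZMod (2 * n)) ≠ 0 := by
  rw [Ne, ZMod.natCast_eq_zero_iff]
  exact fun h => absurd (Nat.le_of_dvd hn h) (by omega)

theorem half_mem_twice_iff {n : ℕ} : (n : ZMod (2 * n)) ∈ twice (ZMod (2 * n)) ↔ Even n := by
  constructor
  · rintro ⟨y, hy⟩
    have h := congrArg (ZMod.castHom (Dvd.intro n rfl : 2 ∣ 2 * n) (ZMod 2)) hy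
    rw [map_natCast] at h
    rw [← ZMod.natCast_eq_zero_iff_even, ← h]
    change ZMod.castHom _ (ZMod 2) (2 • y) = 0
    rw [map_nsmul, nsmul_eq_mul, ZMod.natCast_self, zero_mul]
  · rintro ⟨c, hc⟩
    refine ⟨(c : ZMod (2 * n)), ?_⟩
    change 2 • (c : ZMod (2 * n)) = n
    rw [nsmul_eq_mul, ← Nat.cast_mul, two_mul c, ← hc]

theorem card_two_torsion {n : ℕ} (hn : 0 < n) :
    Nat.card {x : ZMod (2 * n) // 2 • x = 0} = 2 := by
  rw [Nat.card_congr (Equiv.subtypeEquivRight (two_nsmul_eq_zero_iff hn))]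
  exact Set.ncard_pair (half_ne_zero hn).symm

theorem card_two_torsion_of_odd {m : ℕ} (hm : Odd m) : Nat.card {x : ZMod m // 2 • x = 0} = 1 := by
  rw [Nat.card_congr (Equiv.subtypeEquivRight (two_nsmul_eq_zero_iff_of_odd hm))]
  exact Set.ncard_singleton _

theorem card_twice_inter_two_torsion_of_even {n : ℕ} (hn : 0 < n) (he : Even n) :
    Nat.card {x : ZMod (2 * n) // x ∈ twice (ZMod (2 * n)) ∧ 2 • x = 0} = 2 := by
  refine (Nat.card_congr (Equiv.subtypeEquivRight fun x => and_iff_right_of_imp fun h => ?_)).trans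
    (card_two_torsion hn)
  rcases (two_nsmul_eq_zero_iff hn x).mp h with rfl | rfl
  · exact zero_mem _
  · exact half_mem_twice_iff.mpr he

theorem card_twice_inter_two_torsion_of_odd {n : ℕ} (ho : Odd n) :
    Nat.card {x : ZMod (2 * n) // x ∈ twice (ZMod (2 * n)) ∧ 2 • x = 0} = 1 := by
  refine (Nat.card_congr (Equiv.subtypeEquivRight (q := fun x => x = 0) fun x => ?_)).trans
    (Set.ncard_singleton _)
  constructor
  · rintro ⟨h1, h2⟩
    rcases (two_nsmul_eq_zero_iff ho.pos x).mp h2 with rfl | rfl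
    · rfl
    · exact absurd (half_mem_twice_iff.mp h1) (Nat.not_even_iff_odd.mpr ho)
  · rintro rfl
    exact ⟨zero_mem _, smul_zero _⟩

theorem card_twice_inter_two_torsion_of_odd_modulus {m : ℕ} (hm : Odd m) :
    Nat.card {x : ZMod m // x ∈ twice (ZMod m) ∧ 2 • x = 0} = 1 := by
  refine (Nat.card_congr (Equiv.subtypeEquivRight fun x => and_iff_right_of_imp fun h => ?_)).trans
    (card_two_torsion_of_odd hm)
  rw [(two_nsmul_eq_zero_iff_of_odd hm x).mp h]
  exact zero_mem _

end ZMod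

theorem Nat.card_subtype_pi {ι : Type*} [Fintype ι] {M : ι → Type*} (p : ∀ i, M i → Prop) :
    Nat.card {x : ∀ i, M i // ∀ i, p i (x i)} = ∏ i, Nat.card {x : M i // p i x} := by
  rw [Nat.card_congr Equiv.subtypePiEquivPi, Nat.card_pi]

theorem Nat.card_subtype_prod {M N : Type*} (p : M → Prop) (q : N → Prop) :
    Nat.card {x : M × N // p x.1 ∧ q x.2} = Nat.card {x : M // p x} * Nat.card {x : N // q x} := by
  rw [Nat.card_congr Equiv.subtypeProdEquivProd, Nat.card_prod]

namespace CyclicProduct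

variable {k k' d' : ℕ} {n : Fin k → ℕ} {n' : Fin k' → ℕ} {m' : Fin d' → ℕ}

/-- The number of elements of a subset that is given by conditions on the single coordinates. -/
theorem card_subtype (p : ∀ i, ZMod (2 * n i) → Prop) (q : ∀ i, ZMod (2 * n' i) → Prop)
    (r : ∀ i, ZMod (m' i) → Prop) (P : CyclicProduct n n' m' → Prop)
    (hP : ∀ x, P x ↔ (∀ i, p i (x.1 i)) ∧ (∀ i, q i (x.2.1 i)) ∧ ∀ i, r i (x.2.2 i)) :
    Nat.card {x // P x} = (∏ i, Nat.card {x // p i x}) * ((∏ i, Nat.card {x // q i x}) *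
      ∏ i, Nat.card {x // r i x}) := by
  rw [Nat.card_congr (Equiv.subtypeEquivRight hP),
    Nat.card_subtype_prod (fun x : ∀ i, ZMod (2 * n i) => ∀ i, p i (x i))
      (fun y : (∀ i, ZMod (2 * n' i)) × (∀ i, ZMod (m' i)) =>
        (∀ i, q i (y.1 i)) ∧ ∀ i, r i (y.2 i)),
    Nat.card_subtype_prod (fun x : ∀ i, ZMod (2 * n' i) => ∀ i, q i (x i))
      (fun x : ∀ i, ZMod (m' i) => ∀ i, r i (x i)),
    Nat.card_subtype_pi, Nat.card_subtype_pi, Nat.card_subtype_pi]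

theorem two_nsmul_eq_zero_iff (x : CyclicProduct n n' m') : 2 • x = 0 ↔
    (∀ i, 2 • x.1 i = 0) ∧ (∀ i, 2 • x.2.1 i = 0) ∧ ∀ i, 2 • x.2.2 i = 0 := by
  simp only [Prod.ext_iff, funext_iff]
  rfl

theorem mem_twice_iff (x : CyclicProduct n n' m') : x ∈ twice (CyclicProduct n n' m') ↔
    (∀ i, x.1 i ∈ twice (ZMod (2 * n i))) ∧ (∀ i, x.2.1 i ∈ twice (ZMod (2 * n' i))) ∧
      ∀ i, x.2.2 i ∈ twice (ZMod (m' i)) := by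
  constructor
  · rintro ⟨y, rfl⟩
    exact ⟨fun i => ⟨y.1 i, rfl⟩, fun i => ⟨y.2.1 i, rfl⟩, fun i => ⟨y.2.2 i, rfl⟩⟩
  · rintro ⟨h1, h2, h3⟩
    choose y1 hy1 using h1
    choose y2 hy2 using h2
    choose y3 hy3 using h3
    exact ⟨(y1, y2, y3), Prod.ext (funext hy1) (Prod.ext (funext hy2) (funext hy3))⟩

theorem finite (hn : ∀ i, 0 < n i) (hn' : ∀ i, Odd (n' i)) (hm' : ∀ i, Odd (m' i)) :
    Finite (CyclicProduct n n' m') := by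
  have h1 : ∀ i, NeZero (2 * n i) := fun i => ⟨by have := hn i; omega⟩
  have h2 : ∀ i, NeZero (2 * n' i) := fun i => ⟨by have := (hn' i).pos; omega⟩
  have h3 : ∀ i, NeZero (m' i) := fun i => ⟨(hm' i).pos.ne'⟩
  infer_instance

theorem card_two_torsion (hn : ∀ i, 0 < n i) (hn' : ∀ i, Odd (n' i)) (hm' : ∀ i, Odd (m' i)) :
    Nat.card {x : CyclicProduct n n' m' // 2 • x = 0} = 2 ^ (k + k') := by
  rw [card_subtype (fun i x => 2 • x = 0) (fun i x => 2 • x = 0) (fun i x => 2 • x = 0) _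
      two_nsmul_eq_zero_iff,
    Finset.prod_congr rfl fun i _ => ZMod.card_two_torsion (hn i),
    Finset.prod_congr rfl fun i _ => ZMod.card_two_torsion (hn' i).pos,
    Finset.prod_congr rfl fun i _ => ZMod.card_two_torsion_of_odd (hm' i)]
  simp [pow_add]

theorem card_twice_two_torsion (hn : ∀ i, 0 < n i ∧ Even (n i)) (hn' : ∀ i, Odd (n' i))
    (hm' : ∀ i, Odd (m' i)) :
    Nat.card {x : twice (CyclicProduct n n' m') // 2 • x = 0} = 2 ^ k := by
  have e : {x : twice (CyclicProduct n n' m') // 2 • x = 0} ≃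
      {x : CyclicProduct n n' m' // x ∈ twice (CyclicProduct n n' m') ∧ 2 • x = 0} :=
    (Equiv.subtypeEquivRight fun x => by rw [← Subtype.coe_inj]; rfl).trans
      (Equiv.subtypeSubtypeEquivSubtypeInter _ fun x => 2 • x = 0)
  rw [Nat.card_congr e, card_subtype (fun i x => x ∈ twice _ ∧ 2 • x = 0)
      (fun i x => x ∈ twice _ ∧ 2 • x = 0) (fun i x => x ∈ twice _ ∧ 2 • x = 0) _
      (fun x => by rw [mem_twice_iff, two_nsmul_eq_zero_iff]; simp only [forall_and]; tauto),
    Finset.prod_congr rfl fun i _ => ZMod.card_twice_inter_two_torsion_of_even (hn i).1 (hn i).2,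
    Finset.prod_congr rfl fun i _ => ZMod.card_twice_inter_two_torsion_of_odd (hn' i),
    Finset.prod_congr rfl fun i _ => ZMod.card_twice_inter_two_torsion_of_odd_modulus (hm' i)]
  simp

/-- If `2H` has exponent at most two, then `4H = 0`, and `H` is a product of copies of `ℤ/2` and
`ℤ/4`. -/
theorem exists_two_nsmul_ne_zero (hn : ∀ i, 0 < n i ∧ Even (n i)) (hn' : ∀ i, Odd (n' i))
    (hm' : ∀ i, Odd (m' i))
    (hH : ∀ a b : ℕ,
      IsEmpty (CyclicProduct n n' m' ≃+ (Fin a → ZMod 2) × (Fin b → ZMod 4))) :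
    ∃ x : twice (CyclicProduct n n' m'), 2 • x ≠ 0 := by
  by_contra! h
  have h4 : ∀ x : CyclicProduct n n' m', 4 • x = 0 := fun x => by
    have h1 : 2 • 2 • x = 0 := congrArg Subtype.val (h (twice.mk x))
    rwa [← mul_smul] at h1
  have hdvd : ∀ m : ℕ, 4 • (1 : ZMod m) = 0 → m ∣ 4 := fun m hm => by
    rw [nsmul_one] at hm
    exact (ZMod.natCast_eq_zero_iff 4 m).mp hm
  have h0 := h4 (fun _ => 1, fun _ => 1, fun _ => 1)
  obtain rfl : n = fun _ => 2 := funext fun i => by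
    have h1 := hdvd (2 * n i) (congrFun (congrArg Prod.fst h0) i)
    have h2 := Nat.le_of_dvd two_pos (Nat.dvd_of_mul_dvd_mul_left two_pos (h1 : 2 * n i ∣ 2 * 2))
    obtain ⟨h3, c, hc⟩ := hn i
    omega
  obtain rfl : n' = fun _ => 1 := funext fun i => by
    have h1 := hdvd (2 * n' i) (congrFun (congrArg (fun x => x.2.1) h0) i)
    have h2 := Nat.le_of_dvd two_pos (Nat.dvd_of_mul_dvd_mul_left two_pos (h1 : 2 * n' i ∣ 2 * 2))
    obtain ⟨c, hc⟩ := hn' i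
    omega
  obtain rfl : m' = fun _ => 1 := funext fun i => by
    have h1 := hdvd (m' i) (congrFun (congrArg (fun x => x.2.2) h0) i)
    have h2 := Nat.le_of_dvd (by norm_num) h1
    have h3 := hm' i
    revert h1 h3
    generalize m' i = m at h2
    interval_cases m <;> decide
  exact (hH k' k).false
    { toFun := fun x => (x.2.1, x.1)
      invFun := fun y => (y.2, y.1, 0)
      left_inv := fun x => Prod.ext rfl (Prod.ext rfl (funext fun i => Subsingleton.elim
        (α := ZMod 1) _ _))
      right_inv := fun y => rfl
      map_add' := fun x y => rfl }

end CyclicProduct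

/-! ### The decomposition of the span of an orbit -/

namespace Dih

variable {A : Type*} [AddCommGroup A] [Finite A] (K : Type*) [RCLike K]

theorem funRep_reFun_of_eq_neg (χ : AddChar A ℂ) (h : χ = -χ) (d : Dih A) :
    funRep A K d (reFun K χ) = (realChar K χ h d : K) • reFun K χ := by
  refine induction (p := fun d => funRep A K d (reFun K χ) = (realChar K χ h d : K) • reFun K χ)
    (fun a => ?_) ?_ (fun x y hx hy => ?_) d
  · rw [funRep_r_reFun, realChar_r, (eq_neg_iff_imFun_eq_zero K χ).mp h, smul_zero, add_zero]
  · rw [funRep_s_reFun, realChar_s, Units.val_one, one_smul]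
  · rw [map_mul, Module.End.mul_apply, hy, map_smul, hx, map_mul, Units.val_mul, smul_smul,
      mul_comm]

theorem range_charMap_of_eq_neg (χ : AddChar A ℂ) (h : χ = -χ) :
    LinearMap.range (charMap K χ) ≤ Submodule.span K {reFun K χ} := by
  rintro _ ⟨v, rfl⟩
  refine Submodule.mem_span_singleton.mpr ⟨v 0, ?_⟩
  ext x
  rw [charMap_apply, (eq_neg_iff_imFun_eq_zero K χ).mp h]
  simp

/-- The real characters and one character out of each remaining pair `{χ, χ⁻¹}` account for all
functions on `A`. -/
theorem iSup_line_plane {ι κ : Type*} (i : ι → AddChar A ℂ) (j : κ → AddChar A ℂ)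
    (hi : ∀ χ : AddChar A ℂ, χ = -χ → χ ∈ Set.range i)
    (hj : ∀ χ : AddChar A ℂ, χ ≠ -χ → χ ∈ Set.range j ∨ -χ ∈ Set.range j) :
    ⨆ p, Sum.elim (fun x => Submodule.span K {reFun K (i x)})
      (fun y => LinearMap.range (charMap K (j y))) p = ⊤ := by
  refine eq_top_iff.mpr ((iSup_range_charMap K (A := A)).symm.le.trans (iSup_le fun χ => ?_))
  by_cases h : χ = -χ
  · obtain ⟨x, rfl⟩ := hi χ h
    exact (range_charMap_of_eq_neg K _ h).trans (le_iSup_of_le (Sum.inl x) le_rfl)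
  · rcases hj χ h with ⟨y, hy⟩ | ⟨y, hy⟩
    · exact le_iSup_of_le (Sum.inr y) (by rw [← hy]; exact le_rfl)
    · exact le_iSup_of_le (Sum.inr y) (by rw [Sum.elim_inr, hy, range_charMap_neg])

end Dih

namespace Takasaki

variable {H : Type*} [AddCommGroup H] [Finite H] (K : Type*) [RCLike K]
  (ω : InnOrbit (Takasaki H)) (a : H) (ha : mk a ∈ ω.orbit) (hH : ∃ x : twice H, 2 • x ≠ 0)
  (χ : AddChar (twice H) ℂ)

/-- The line in `K[X_ω]` spanned by a real character of `2H`. -/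
noncomputable def line (h : χ = -χ) : Subrepresentation (QuandleRing.orbitRep K ω) where
  toSubmodule := (Submodule.span K {Dih.reFun K χ}).map (funEquiv ω a ha K).toLinearMap
  apply_mem_toSubmodule := by
    rintro g _ ⟨f, hf, rfl⟩
    obtain ⟨t, rfl⟩ := Submodule.mem_span_singleton.mp hf
    refine ⟨_, ?_, (orbitRep_funEquiv ω a ha K hH g _).symm⟩
    rw [map_smul, Dih.funRep_reFun_of_eq_neg K χ h]
    exact Submodule.smul_mem _ _ (Submodule.smul_mem _ _ (Submodule.mem_span_singleton_self _))

theorem orbitRep_line (h : χ = -χ) (g : InnOn ω) :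
    ∀ u ∈ (line K ω a ha hH χ h).toSubmodule, QuandleRing.orbitRep K ω g u =
      (Dih.realChar K χ h (innOnEquiv ω a ha hH g) : K) • u := by
  rintro _ ⟨f, hf, rfl⟩
  obtain ⟨t, rfl⟩ := Submodule.mem_span_singleton.mp hf
  refine (orbitRep_funEquiv ω a ha K hH g _).trans ?_
  rw [map_smul, Dih.funRep_reFun_of_eq_neg K χ h, smul_comm, map_smul]
  rfl

theorem finrank_line (h : χ = -χ) :
    Module.finrank K (line K ω a ha hH χ h).toSubmodule = 1 :=
  (LinearEquiv.finrank_map_eq (funEquiv ω a ha K) _).trans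
    (finrank_span_singleton (Dih.reFun_ne_zero K χ))

theorem isSimpleRightIdeal_line (h : χ = -χ) : QuandleRing.IsSimpleRightIdeal
    ((line K ω a ha hH χ h).toSubmodule.map (QuandleRing.orbitIncl K ω)) := by
  have : Finite (Takasaki H) := ‹Finite H›
  have hfin := finrank_line K ω a ha hH χ h
  refine QuandleRing.isSimpleRightIdeal_map_orbitIncl ω _
    (fun g _ hw => Subrepresentation.apply_mem_toSubmodule _ g hw) ?_ fun J _ hJ => ?_
  · intro hbot
    rw [hbot, finrank_bot] at hfin
    exact zero_ne_one hfin
  · by_cases hJ0 : J = ⊥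
    · exact Or.inl hJ0
    · refine Or.inr (Submodule.eq_of_le_of_finrank_le hJ ?_)
      rw [hfin]
      exact Submodule.one_le_finrank_iff.mpr hJ0

/-- The inclusion of the representation of degree two of a character `χ` of `2H` in `K[X_ω]`. -/
noncomputable def planeMap : (Fin 2 → K) →ₗ[K] (ω.orbit →₀ K) :=
  (funEquiv ω a ha K).toLinearMap ∘ₗ Dih.charMap K χ

theorem orbitRep_planeMap (g : InnOn ω) (v : Fin 2 → K) :
    QuandleRing.orbitRep K ω g (planeMap K ω a ha χ v) =
      planeMap K ω a ha χ (Dih.rotRep K χ (innOnEquiv ω a ha hH g) v) := by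
  refine (orbitRep_funEquiv ω a ha K hH g _).trans ?_
  rw [← Dih.charMap_intertwines]
  rfl

theorem planeMap_injective (h : χ ≠ -χ) : Function.Injective (planeMap K ω a ha χ) :=
  (funEquiv ω a ha K).injective.comp (Dih.charMap_injective K χ h)

/-- The subspace of `K[X_ω]` spanned by the real and the imaginary part of a character of `2H`. -/
noncomputable def plane : Subrepresentation (QuandleRing.orbitRep K ω) where
  toSubmodule := LinearMap.range (planeMap K ω a ha χ)
  apply_mem_toSubmodule := by
    rintro g _ ⟨v, rfl⟩
    exact ⟨_, (orbitRep_planeMap K ω a ha hH χ g v).symm⟩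

theorem finrank_plane (h : χ ≠ -χ) :
    Module.finrank K (plane K ω a ha hH χ).toSubmodule = 2 :=
  (LinearMap.finrank_range_of_inj (planeMap_injective K ω a ha χ h)).trans
    (Module.finrank_fin_fun K)

theorem plane_equiv (h : χ ≠ -χ) : Nonempty ((plane K ω a ha hH χ).toRepresentation.Equiv
    (MonoidHom.comp (Dih.rotRep K χ) (innOnEquiv ω a ha hH).toMonoidHom)) := by
  refine ⟨(Representation.Equiv.mk
    (ρ := MonoidHom.comp (Dih.rotRep K χ) (innOnEquiv ω a ha hH).toMonoidHom)
    (LinearEquiv.ofInjective _ (planeMap_injective K ω a ha χ h)) fun g => ?_).symm⟩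
  refine LinearMap.ext fun v => Subtype.ext ?_
  exact (orbitRep_planeMap K ω a ha hH χ g v).symm

theorem isSimpleRightIdeal_plane (h : χ ≠ -χ) : QuandleRing.IsSimpleRightIdeal
    ((plane K ω a ha hH χ).toSubmodule.map (QuandleRing.orbitIncl K ω)) := by
  have : Finite (Takasaki H) := ‹Finite H›
  refine QuandleRing.isSimpleRightIdeal_map_orbitIncl ω _
    (fun g _ hw => Subrepresentation.apply_mem_toSubmodule _ g hw) ?_ fun J hJinv hJ => ?_
  · intro hbot
    have hfin := finrank_plane K ω a ha hH χ h
    rw [hbot, finrank_bot] at hfin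
    exact absurd hfin (by norm_num)
  · have hJ' : (J.comap (planeMap K ω a ha χ)).map (planeMap K ω a ha χ) = J :=
      Submodule.map_comap_eq_of_le hJ
    have hinv : ∀ d, ∀ v ∈ J.comap (planeMap K ω a ha χ),
        Dih.rotRep K χ d v ∈ J.comap (planeMap K ω a ha χ) := fun d v hv => by
      have h1 := hJinv ((innOnEquiv ω a ha hH).symm d) _ hv
      rwa [orbitRep_planeMap K ω a ha hH, MulEquiv.apply_symm_apply] at h1
    rcases Dih.eq_bot_or_eq_top_of_rotRep_invariant K χ h _ hinv with h1 | h1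
    · exact Or.inl (by rw [← hJ', h1, Submodule.map_bot])
    · exact Or.inr (by rw [← hJ', h1, Submodule.map_top]; rfl)

theorem iSup_line_plane {ι κ : Type*} (i : ι → AddChar (twice H) ℂ)
    (j : κ → AddChar (twice H) ℂ) (hi0 : ∀ x, i x = -i x)
    (hi : ∀ χ : AddChar (twice H) ℂ, χ = -χ → χ ∈ Set.range i)
    (hj : ∀ χ : AddChar (twice H) ℂ, χ ≠ -χ → χ ∈ Set.range j ∨ -χ ∈ Set.range j) :
    ⨆ p, Sum.elim (fun x => (line K ω a ha hH (i x) (hi0 x)).toSubmodule)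
      (fun y => (plane K ω a ha hH (j y)).toSubmodule) p = ⊤ := by
  have h := congrArg (Submodule.map (funEquiv ω a ha K).toLinearMap)
    (Dih.iSup_line_plane K i j hi hj)
  rw [Submodule.map_iSup, Submodule.map_top, LinearEquiv.range] at h
  rw [← h]
  refine iSup_congr fun p => ?_
  rcases p with x | y
  · rfl
  · exact LinearMap.range_comp _ _

theorem sum_finrank_line_plane {ι κ : Type*} [Fintype ι] [Fintype κ]
    (i : ι → AddChar (twice H) ℂ) (j : κ → AddChar (twice H) ℂ) (hi : ∀ x, i x = -i x)
    (hj : ∀ y, j y ≠ -j y) :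
    ∑ p, Module.finrank K (Sum.elim (fun x => (line K ω a ha hH (i x) (hi x)).toSubmodule)
      (fun y => (plane K ω a ha hH (j y)).toSubmodule) p : Submodule K (ω.orbit →₀ K)) =
        Fintype.card ι + 2 * Fintype.card κ := by
  rw [Fintype.sum_sum_type]
  refine (congrArg₂ (· + ·)
    (Finset.sum_congr rfl fun x _ => finrank_line K ω a ha hH _ (hi x))
    (Finset.sum_congr rfl fun y _ => finrank_plane K ω a ha hH _ (hj y))).trans ?_
  simp [mul_comm]

end Takasaki

/-! ### The quandle ring of the Takasaki quandle of a product of cyclic groups -/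

open QuandleRing in
theorem mainTheorem2 {K : Type*} [RCLike K] {k k' d' : ℕ}
    (n : Fin k → ℕ) (n' : Fin k' → ℕ) (m' : Fin d' → ℕ)
    (hn : ∀ i, 0 < n i ∧ Even (n i)) (hn' : ∀ i, Odd (n' i)) (hm' : ∀ i, Odd (m' i))
    (hH : ∀ a b : ℕ,
      IsEmpty (CyclicProduct n n' m' ≃+ (Fin a → ZMod 2) × (Fin b → ZMod 4))) :
    let H := CyclicProduct n n' m'
    let T := Takasaki H
    let D := Dih (twice H)
    let N := (Nat.card (twice H) - 2 ^ k) / 2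
    -- the number of orbits, and the splitting of `K[T]` over them
    Nat.card (InnOrbit T) = 2 ^ (k + k') ∧
    (∀ ω : InnOrbit T, IsRightIdeal (LinearMap.range (orbitIncl K ω))) ∧
    IsDirectSumOf (fun ω : InnOrbit T => LinearMap.range (orbitIncl K ω)) ∧
    -- `φ` lists, without repetition, all characters of `Dih(2H)` with value `1` at `s`
    ∃ φ : Fin (2 ^ k) → (D →* Kˣ),
      (Function.Injective φ ∧ ∀ χ : D →* Kˣ, χ Dih.s = 1 ↔ χ ∈ Set.range φ) ∧
    -- `ψ` lists, up to equivalence and without repetition, all irreducible representations of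
    -- `Dih(2H)` of degree two
    ∃ ψ : Fin N → Representation K D (Fin 2 → K),
      ((∀ j, (ψ j).IsIrreducible) ∧
        ∀ σ : Representation K D (Fin 2 → K), σ.IsIrreducible →
          ∃! j, Nonempty (σ.Equiv (ψ j))) ∧
    -- `a` is any choice of a base point in each orbit
    ∀ a : InnOrbit T → H, (∀ ω, (a ω : T) ∈ ω.orbit) →
      -- the identification of `Inn(X_ω)` with `Dih(2H)`; it sends `R_{a ω}` to `s`
      ∃ e : ∀ ω : InnOrbit T, InnOn ω ≃* D,
        (∀ (ω : InnOrbit T) (b : H),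
          e ω (InnOn.rightMul ω (b : T)) = Dih.r (twice.mk (b - a ω)) * Dih.s) ∧
      ∃ (U : ∀ ω : InnOrbit T, Fin (2 ^ k) → Subrepresentation (orbitRep K ω))
        (V : ∀ ω : InnOrbit T, Fin N → Subrepresentation (orbitRep K ω)),
        (∀ ω j, Module.finrank K (U ω j).toSubmodule = 1 ∧
          ∀ g : InnOn ω, ∀ u ∈ (U ω j).toSubmodule,
            orbitRep K ω g u = (φ j (e ω g) : K) • u) ∧
        (∀ ω j, Nonempty
          ((V ω j).toRepresentation.Equiv (MonoidHom.comp (ψ j) (e ω).toMonoidHom))) ∧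
        (∀ ω j, IsSimpleRightIdeal ((U ω j).toSubmodule.map (orbitIncl K ω))) ∧
        (∀ ω j, IsSimpleRightIdeal ((V ω j).toSubmodule.map (orbitIncl K ω))) ∧
        (∀ ω, IsDirectSumOf (Sum.elim (fun j => (U ω j).toSubmodule)
          (fun j => (V ω j).toSubmodule))) ∧
        IsDirectSumOf (fun p : InnOrbit T × (Fin (2 ^ k) ⊕ Fin N) =>
          (Sum.elim (fun j => (U p.1 j).toSubmodule)
            (fun j => (V p.1 j).toSubmodule) p.2).map (orbitIncl K p.1)) := by

  intro H T D N
  have hfin : Finite H := CyclicProduct.finite (fun i => (hn i).1) hn' hm'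
  have hfinT : Finite T := hfin
  have hH2 : ∃ x : twice H, 2 • x ≠ 0 := CyclicProduct.exists_two_nsmul_ne_zero hn hn' hm' hH
  have hreal : Nat.card {χ : AddChar (twice H) ℂ // χ = -χ} = 2 ^ k :=
    (card_real_addChar (twice H)).trans (CyclicProduct.card_twice_two_torsion hn hn' hm')
  obtain ⟨P, hP1, hP2, hP3, hP4⟩ := exists_transversal_neg (AddChar (twice H) ℂ)
  have hdual : Nat.card (AddChar (twice H) ℂ) = Nat.card (twice H) := by
    have := Fintype.ofFinite (twice H)
    rw [Nat.card_eq_fintype_card, Nat.card_eq_fintype_card, AddChar.card_eq]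
  have hsum : Nat.card (twice H) = 2 ^ k + 2 * Nat.card P := by rw [← hdual, hP4, hreal]
  have hN : Nat.card P = N := by
    change _ = (Nat.card (twice H) - 2 ^ k) / 2
    omega
  -- enumerations of the real characters and of the chosen non-real ones
  let i : Fin (2 ^ k) ≃ {χ : AddChar (twice H) ℂ // χ = -χ} := (Finite.equivFinOfCardEq hreal).symm
  let j : Fin N ≃ P := (Finite.equivFinOfCardEq hN).symm
  have hj0 : ∀ y, (j y).1 ≠ -(j y).1 := fun y => hP1 _ (j y).2
  have hi : ∀ χ : AddChar (twice H) ℂ, χ = -χ → χ ∈ Set.range fun x => (i x).1 := fun χ h =>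
    ⟨i.symm ⟨χ, h⟩, by simp⟩
  have hj : ∀ χ : AddChar (twice H) ℂ, χ ≠ -χ →
      χ ∈ Set.range (fun y => (j y).1) ∨ -χ ∈ Set.range fun y => (j y).1 := fun χ h =>
    (hP2 χ h).imp (fun h => ⟨j.symm ⟨χ, h⟩, by simp⟩) fun h => ⟨j.symm ⟨-χ, h⟩, by simp⟩
  refine ⟨?_, fun ω => ?_, isDirectSumOf_range_orbitIncl,
    fun x => Dih.realChar K (i x).1 (i x).2, ⟨fun x y hxy => ?_, fun χ => ⟨fun hχ => ?_, ?_⟩⟩,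
    fun y => Dih.rotRep K (j y).1, ⟨fun y => Dih.rotRep_isIrreducible K _ (hj0 y),
      fun σ hσ => ?_⟩, fun a ha => ?_⟩
  · exact (Takasaki.card_innOrbit H).trans
      (CyclicProduct.card_two_torsion (fun i => (hn i).1) hn' hm')
  · rw [← Submodule.map_top]
    exact isRightIdeal_map_orbitIncl ω ⊤ fun _ _ _ => Submodule.mem_top
  · exact i.injective (Subtype.ext (Dih.realChar_injective K _ _ hxy))
  · obtain ⟨η, hη, rfl⟩ := Dih.exists_realChar_eq K χ hχ
    exact ⟨i.symm ⟨η, hη⟩, by simp⟩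
  · rintro ⟨x, rfl⟩
    exact Dih.realChar_s K _ _
  · obtain ⟨χ, hχ, ⟨L⟩⟩ := Dih.exists_rotRep_equiv K σ hσ
    have hex : ∃ y, Nonempty (σ.Equiv (Dih.rotRep K (j y).1)) := by
      rcases hj χ hχ with ⟨y, hy⟩ | ⟨y, hy⟩
      · refine ⟨y, ⟨?_⟩⟩
        rw [show (j y).1 = χ from hy]
        exact L.symm
      · obtain ⟨L'⟩ := Dih.rotRep_neg_equiv K χ
        refine ⟨y, ⟨?_⟩⟩
        rw [show (j y).1 = -χ from hy]
        exact L.symm.trans L'.symm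
    obtain ⟨y, ⟨Ly⟩⟩ := hex
    refine ⟨y, ⟨Ly⟩, ?_⟩
    rintro z ⟨Lz⟩
    rcases Dih.eq_or_eq_neg_of_rotRep_equiv K (j z).1 ⟨Lz.symm.trans Ly⟩ with h | h
    · exact j.injective (Subtype.ext h.symm)
    · exact absurd (h ▸ (j y).2) (hP3 _ (j z).2)
  · have hsup := fun ω => Takasaki.iSup_line_plane K ω (a ω) (ha ω) hH2 (fun x => (i x).1)
      (fun y => (j y).1) (fun x => (i x).2) hi hj
    have hdim := fun ω => (Takasaki.sum_finrank_line_plane K ω (a ω) (ha ω) hH2 (fun x => (i x).1)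
      (fun y => (j y).1) (fun x => (i x).2) hj0).trans
        (show _ = Nat.card ω.orbit by
          rw [Fintype.card_fin, Fintype.card_fin, ← hN, ← hsum,
            Nat.card_congr (Takasaki.orbitEquiv ω (a ω) (ha ω))])
    refine ⟨fun ω => Takasaki.innOnEquiv ω (a ω) (ha ω) hH2,
      fun ω b => Takasaki.innOnEquiv_rightMul ω (a ω) (ha ω) hH2 b,
      fun ω x => Takasaki.line K ω (a ω) (ha ω) hH2 (i x).1 (i x).2,
      fun ω y => Takasaki.plane K ω (a ω) (ha ω) hH2 (j y).1, fun ω x => ⟨?_, fun g => ?_⟩,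
      fun ω y => ?_, fun ω x => ?_, fun ω y => ?_, fun ω => ?_, ?_⟩
    · exact Takasaki.finrank_line K ω (a ω) (ha ω) hH2 _ (i x).2
    · exact Takasaki.orbitRep_line K ω (a ω) (ha ω) hH2 _ (i x).2 g
    · exact Takasaki.plane_equiv K ω (a ω) (ha ω) hH2 _ (hj0 y)
    · exact Takasaki.isSimpleRightIdeal_line K ω (a ω) (ha ω) hH2 _ (i x).2
    · exact Takasaki.isSimpleRightIdeal_plane K ω (a ω) (ha ω) hH2 _ (hj0 y)
    · exact isDirectSumOf_of_iSup_eq_top _ (hsup ω)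
        ((hdim ω).trans (finrank_finsupp_orbit ω).symm)
    · exact isDirectSumOf_map_orbitIncl (fun ω => Sum.elim
        (fun x => (Takasaki.line K ω (a ω) (ha ω) hH2 (i x).1 (i x).2).toSubmodule)
        (fun y => (Takasaki.plane K ω (a ω) (ha ω) hH2 (j y).1).toSubmodule)) hsup hdim
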